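/- **Calculus.** Let $\mathcal X$ and $\mathcal{QN}$ be disjoint countably infinite sets of channel names $x,y,\dots$ and stochastic names $q,\dots$; rates $\lambda$ are positive reals. The set $\mathcal P_{ext}$ of terms is given by $$P ::= M \mid P|P' \mid (\nu x)P \mid (\nu q\to\lambda)P \mid A(x_1,\dots,x_n),\qquad M ::= \mathbf 0\mid \alpha.P\mid M+M',\qquad \alpha ::= \overline{x}\langle y\rangle \mid x(y)\mid\tau\mid(\lambda)\mid(q),$$ modulo $\alpha$-conversion, where $x(y).P$ and $(\nu y)P$ bind $y$, and $(\nu q\to\lambda)P$ binds $q$, in $P$. The set $\mathcal P\subseteq\mathcal P_{ext}$ of plain terms consists of the terms without prefixes $(q)$ and without binders $(\nu q\to\lambda)$. Every constant $A$ has one definition $A(\tilde x)\stackrel{\rm def}{=}P$ with $P\in\mathcal P$, distinct parameters $\tilde x$ and $fn(P)\subseteq\tilde x$; from $P$ one can reach, by finitely many replacements of constants by their instantiated defining terms, a term in which every constant is in the scope of a prefix (weak guardedness). **Labeled semantics** (on $\mathcal P$). The transitions $P\xrightarrow{\mu}P'$ are those of the standard early semantics of the $\pi$-calculus (labels $\tau$,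 $\overline xy$, $\overline x(y)$, $xy$), with the rule that $A(\tilde y)$ has the transitions of $P\{\tilde y/\tilde x\}$ if $A(\tilde x)\stackrel{\rm def}{=}P$. The Markovian transitions $P\xrightarrow{\lambda,id}P'$, where $id$ is a string over $\{+_0,+_1,|_0,|_1\}$, are generated by: $(\lambda).P\xrightarrow{\lambda,\varepsilon}P$; if $M\xrightarrow{\lambda,id}P'$ then $M+N\xrightarrow{\lambda,+_0id}P'$ and $N+M\xrightarrow{\lambda,+_1id}P'$; if $P\xrightarrow{\lambda,id}P'$ then $P|Q\xrightarrow{\lambda,|_0id}P'|Q$, $Q|P\xrightarrow{\lambda,|_1id}Q|P'$ and $(\nu x)P\xrightarrow{\lambda,id}(\nu x)P'$; if $P\{\tilde y/\tilde x\}\xrightarrow{\lambda,id}P'$ and $A(\tilde x)\stackrel{\rm def}{=}P$ then $A(\tilde y)\xrightarrow{\lambda,id}P'$. **Structural congruence.** Let $(\nu\theta)$ stand for any binder $(\nu x)$ or $(\nu q\to\lambda)$ of the name $\theta$. Then $\equiv$ is the smallest congruence on $\mathcal P_{ext}$ such that $+$ and $|$ are associative and commutative with unit $\mathbf 0$ (the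 laws of $+$ being for summations $M$), $(\nu\theta)P|Q\equiv(\nu\theta)(P|Q)$ if $\theta\notin fn(Q)$, $(\nu\theta)(\nu\theta')P\equiv(\nu\theta')(\nu\theta)P$ if $\theta\ne\theta'$, $(\nu\theta)\mathbf 0\equiv\mathbf 0$, $A(\tilde y)\equiv P\{\tilde y/\tilde x\}$ if $A(\tilde x)\stackrel{\rm def}{=}P$, and $(\lambda).P+M\equiv(\nu q\to\lambda)((q).P+M)$ if $q\notin fn(M,P)$. **Reduction semantics** (on $\mathcal P_{ext}$). Reductions $P\to P'$ and symbolic delay transitions $P\xrightarrow{q}P'$ are generated by $(q).P+M\xrightarrow{q}P$, $\ \tau.P+M\to P$, $\ x(z).P+M\mid\overline x\langle y\rangle.Q+N\to P\{y/z\}|Q$, and by closure of both under $\cdot\,|Q$, under binders (a binder of $q$ is excluded for $\xrightarrow{q}$), and under $\equiv$ on both sides. A rate distribution is a non-empty finite multiset of pairs $(\lambda,[P]_\equiv)$ with $P\in\mathcal P_{ext}$; let $\mu_\sigma(e)$ be the multiplicity of $e$ in $\sigma$, and let $(\nu q\to\lambda)\sigma$ be obtained from $\sigma$ by replacing each element $(\lambda',[P]_\equiv)$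 by $(\lambda',[(\nu q\to\lambda)P]_\equiv)$. The stochastic transitions $P\to\sigma$ are generated by the following rules (the negative premise is well founded): if $P\xrightarrow{q}P'$ and $P\to\sigma$, then $(\nu q\to\lambda)P\to(\nu q\to\lambda)\sigma\cup\{\!|(\lambda,[(\nu q\to\lambda)P']_\equiv)|\!\}$; if $P\xrightarrow{q}P'$ and $P$ has no stochastic transition, then $(\nu q\to\lambda)P\to\{\!|(\lambda,[(\nu q\to\lambda)P']_\equiv)|\!\}$; if $P\equiv Q$ and $Q\to\sigma$, then $P\to\sigma$. **Theorem (Harmony).** Let $P\in\mathcal P$. 1. For every $P'\in\mathcal P_{ext}$: $P\to P'$ if and only if $P\xrightarrow{\tau}Q$ for some $Q$ with $Q\equiv P'$. 2. $P\to\sigma$ for some $\sigma$ if and only if $P\xrightarrow{\lambda,id}P'$ for some $\lambda$, $id$ and $P'$. Moreover, when both hold, for every $\sigma$ with $P\to\sigma$ and every $P'\in\mathcal P$, $P$ has only finitely many Markovian transitions into terms congruent to $P'$, and $$\sum_{(\lambda,[P']_{\equiv})\in\sigma}\lambda\cdot\mu_\sigma(\lambda,[P']_\equiv)\;=\;\sum_{P\xrightarrow{\lambda,id}Q,\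 Q\equiv P'}\lambda ,$$ where the left sum is over the distinct pairs in $\sigma$ with second component $[P']_\equiv$ and the right sum is over the Markovian transitions of $P$ into terms congruent to $P'$. -/

import Mathlib

/-!
# The Markovian π-calculus: syntax, labeled semantics and reduction semantics

Terms are taken modulo α-conversion, by means of de Bruijn indices.  There are two independent
sorts of names, both indexed by `ℕ`: channel names (bound by `(ν x)` and by the input prefix) and
stochastic names (bound by the stochastic binder `(ν q → r)`).  Below a binder, the bound name is
the index `0` of its sort and every other name `n` of that sort is written `n + 1`.
-/

universe u

namespace MPi

/-- Rates: positive real numbers. -/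
abbrev Rate : Type := {r : ℝ // 0 < r}

/-- A set of constants with their arities. -/
structure Sig where
  Const : Type u
  arity : Const → ℕ

/-- Prefixes of the extended calculus: output, input (binds one channel name in the
continuation), silent prefix, Markovian delay `(r)`, and delay `(q)` with a stochastic name. -/
inductive Prefix : Type
  | out (x y : ℕ)
  | inp (x : ℕ)
  | tau
  | rate (r : Rate)
  | delay (q : ℕ)

mutual

/-- Terms of the extended calculus. -/
inductive Proc (S : Sig.{u}) : Type u
  /-- a summation -/
  | sum (M : Summ S) : Proc S
  /-- parallel composition -/
  | par (P Q : Proc S) : Proc S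
  /-- `(ν x) P` -/
  | res (P : Proc S) : Proc S
  /-- the stochastic binder `(ν q → r) P` -/
  | sres (r : Rate) (P : Proc S) : Proc S
  /-- `A(y₁, …, yₙ)` -/
  | call (A : S.Const) (y : Fin (S.arity A) → ℕ) : Proc S

/-- Summations of the extended calculus. -/
inductive Summ (S : Sig.{u}) : Type u
  | nil : Summ S
  | pre (α : Prefix) (P : Proc S) : Summ S
  | plus (M N : Summ S) : Summ S

end

/-- A renaming under a binder. -/
def up (ρ : ℕ → ℕ) : ℕ → ℕ
  | 0 => 0
  | n + 1 => ρ n + 1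

/-- The transposition of the names `0` and `1`. -/
def swap01 : ℕ → ℕ
  | 0 => 1
  | 1 => 0
  | n + 2 => n + 2

/-- The map that sends the name `0` to `w` and lowers all other names. -/
def instMap (w : ℕ) : ℕ → ℕ
  | 0 => w
  | n + 1 => n

namespace Prefix

/-- Renaming of the free channel names (by `ρ`) and stochastic names (by `κ`) of a prefix. -/
def rename (ρ κ : ℕ → ℕ) : Prefix → Prefix
  | out x y => out (ρ x) (ρ y)
  | inp x => inp (ρ x)
  | tau => tau
  | rate r => rate r
  | delay q => delay (κ q)

/-- The renaming of channel names to be applied to the continuation of a prefix. -/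
def under (ρ : ℕ → ℕ) : Prefix → ℕ → ℕ
  | inp _ => up ρ
  | _ => ρ

/-- Free channel names of `α.P`, where `s` is the set of free channel names of `P`. -/
def fn (s : Set ℕ) : Prefix → Set ℕ
  | out x y => {x, y} ∪ s
  | inp x => {x} ∪ {n | n + 1 ∈ s}
  | _ => s

/-- The prefix has no stochastic name. -/
def Plain : Prefix → Prop
  | delay _ => False
  | _ => True

end Prefix

mutual

/-- Capture-avoiding renaming of free channel names (by `ρ`) and stochastic names (by `κ`). -/
def Proc.rename {S : Sig.{u}} (ρ κ : ℕ → ℕ) : Proc S → Proc S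
  | .sum M => .sum (M.rename ρ κ)
  | .par P Q => .par (P.rename ρ κ) (Q.rename ρ κ)
  | .res P => .res (P.rename (up ρ) κ)
  | .sres r P => .sres r (P.rename ρ (up κ))
  | .call A y => .call A (fun i => ρ (y i))

/-- Capture-avoiding renaming in summations. -/
def Summ.rename {S : Sig.{u}} (ρ κ : ℕ → ℕ) : Summ S → Summ S
  | .nil => .nil
  | .pre α P => .pre (α.rename ρ κ) (P.rename (α.under ρ) κ)
  | .plus M N => .plus (M.rename ρ κ) (N.rename ρ κ)

end

mutual

/-- Free channel names. -/
def Proc.fn {S : Sig.{u}} : Proc S → Set ℕ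
  | .sum M => M.fn
  | .par P Q => P.fn ∪ Q.fn
  | .res P => {n | n + 1 ∈ P.fn}
  | .sres _ P => P.fn
  | .call _ y => Set.range y

/-- Free channel names of a summation. -/
def Summ.fn {S : Sig.{u}} : Summ S → Set ℕ
  | .nil => ∅
  | .pre α P => α.fn P.fn
  | .plus M N => M.fn ∪ N.fn

end

mutual

/-- The terms of the plain calculus: neither stochastic names nor stochastic binders occur. -/
def Proc.Plain {S : Sig.{u}} : Proc S → Prop
  | .sum M => M.Plain
  | .par P Q => P.Plain ∧ Q.Plain
  | .res P => P.Plain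
  | .sres _ _ => False
  | .call _ _ => True

/-- Plain summations. -/
def Summ.Plain {S : Sig.{u}} : Summ S → Prop
  | .nil => True
  | .pre α P => α.Plain ∧ P.Plain
  | .plus M N => M.Plain ∧ N.Plain

end

namespace Proc

variable {S : Sig.{u}}

/-- `P` placed under one further channel binder that does not bind in it. -/
def shift (P : Proc S) : Proc S := P.rename Nat.succ id

/-- `P` placed under one further stochastic binder that does not bind in it. -/
def sshift (P : Proc S) : Proc S := P.rename id Nat.succ

/-- `P{w/z}`, where `z` is the channel name `0` of `P`, whose binder is removed. -/
def inst (P : Proc S) (w : ℕ) : Proc S := P.rename (instMap w) id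

/-- `P{y₁/x₁, …, yₖ/xₖ}`, where the parameters `x₁, …, xₖ` are the channel names `0, …, k - 1`. -/
def substParams (P : Proc S) {k : ℕ} (y : Fin k → ℕ) : Proc S :=
  P.rename (fun i => if h : i < k then y ⟨i, h⟩ else i) id

/-- Every constant occurs in the scope of a prefix operator. -/
def Guarded : Proc S → Prop
  | .sum _ => True
  | .par P Q => P.Guarded ∧ Q.Guarded
  | .res P => P.Guarded
  | .sres _ P => P.Guarded
  | .call _ _ => False

/-- The inactive process. -/
def nil : Proc S := .sum .nil

end Proc

/-- `M` placed under one further stochastic binder that does not bind in it. -/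
def Summ.sshift {S : Sig.{u}} (M : Summ S) : Summ S := M.rename id Nat.succ

/-- One occurrence of a constant `B(y₁, …, yₖ)`, anywhere in the term, is replaced by its
instantiated defining term. -/
inductive Unfold {S : Sig.{u}} (body : S.Const → Proc S) : Proc S → Proc S → Prop
  | call (A : S.Const) (y : Fin (S.arity A) → ℕ) :
      Unfold body (.call A y) ((body A).substParams y)
  | parL {P P' : Proc S} (Q : Proc S) : Unfold body P P' → Unfold body (.par P Q) (.par P' Q)
  | parR {Q Q' : Proc S} (P : Proc S) : Unfold body Q Q' → Unfold body (.par P Q) (.par P Q')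
  | res {P P' : Proc S} : Unfold body P P' → Unfold body (.res P) (.res P')
  | sres {P P' : Proc S} (r : Rate) : Unfold body P P' → Unfold body (.sres r P) (.sres r P')
  | pre {P P' : Proc S} (α : Prefix) :
      Unfold body P P' → Unfold body (.sum (.pre α P)) (.sum (.pre α P'))
  | plusL {M M' : Summ S} (N : Summ S) :
      Unfold body (.sum M) (.sum M') → Unfold body (.sum (.plus M N)) (.sum (.plus M' N))
  | plusR {N N' : Summ S} (M : Summ S) :
      Unfold body (.sum N) (.sum N') → Unfold body (.sum (.plus M N)) (.sum (.plus M N'))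

/-- A set of constant definitions `A(x₁, …, xₖ) := P`, one for every constant: `P` is a plain term
whose free names are among the parameters, and the recursion is weakly guarded.  The parameters
of `A` are the channel names `0, …, k - 1` of `P`, where `k` is the arity of `A`. -/
structure Env (S : Sig.{u}) where
  body : S.Const → Proc S
  plain : ∀ A, (body A).Plain
  fn_body : ∀ A, ∀ n ∈ (body A).fn, n < S.arity A
  guarded : ∀ A, ∃ P', Relation.ReflTransGen (Unfold body) (body A) P' ∧ P'.Guarded

/-! ## Labeled operational semantics -/

/-- Labels without bound names: `τ`, free output, early input. -/
inductive FLabel : Type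
  | tau
  | out (x y : ℕ)
  | inp (x y : ℕ)

/-- The same label under one further channel binder, whose name does not occur in it. -/
def FLabel.shift : FLabel → FLabel
  | tau => tau
  | out x y => out (x + 1) (y + 1)
  | inp x y => inp (x + 1) (y + 1)

/-- Labels of the standard transitions.  The bound output `bout x` stands for `x̄(y)`, where `y` is
the channel name `0` of the target (all other names of the target are raised by one). -/
inductive Label : Type
  | free (a : FLabel)
  | bout (x : ℕ)

/-- Standard (early) labeled transitions. -/
inductive LTrans {S : Sig.{u}} (D : Env S) : Proc S → Label → Proc S → Prop
  | tau (P : Proc S) : LTrans D (.sum (.pre .tau P)) (.free .tau) P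
  | out (x y : ℕ) (P : Proc S) : LTrans D (.sum (.pre (.out x y) P)) (.free (.out x y)) P
  | inp (x w : ℕ) (P : Proc S) : LTrans D (.sum (.pre (.inp x) P)) (.free (.inp x w)) (P.inst w)
  | sumL {M : Summ S} {μ : Label} {P' : Proc S} (N : Summ S) :
      LTrans D (.sum M) μ P' → LTrans D (.sum (.plus M N)) μ P'
  | sumR {N : Summ S} {μ : Label} {P' : Proc S} (M : Summ S) :
      LTrans D (.sum N) μ P' → LTrans D (.sum (.plus M N)) μ P'
  | parL {P P' : Proc S} {a : FLabel} (Q : Proc S) :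
      LTrans D P (.free a) P' → LTrans D (.par P Q) (.free a) (.par P' Q)
  | parR {Q Q' : Proc S} {a : FLabel} (P : Proc S) :
      LTrans D Q (.free a) Q' → LTrans D (.par P Q) (.free a) (.par P Q')
  | parBoutL {P P' : Proc S} {x : ℕ} (Q : Proc S) :
      LTrans D P (.bout x) P' → LTrans D (.par P Q) (.bout x) (.par P' Q.shift)
  | parBoutR {Q Q' : Proc S} {x : ℕ} (P : Proc S) :
      LTrans D Q (.bout x) Q' → LTrans D (.par P Q) (.bout x) (.par P.shift Q')
  | commL {P P' Q Q' : Proc S} {x y : ℕ} :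
      LTrans D P (.free (.out x y)) P' → LTrans D Q (.free (.inp x y)) Q' →
      LTrans D (.par P Q) (.free .tau) (.par P' Q')
  | commR {P P' Q Q' : Proc S} {x y : ℕ} :
      LTrans D P (.free (.inp x y)) P' → LTrans D Q (.free (.out x y)) Q' →
      LTrans D (.par P Q) (.free .tau) (.par P' Q')
  | closeL {P P' Q Q' : Proc S} {x : ℕ} :
      LTrans D P (.bout x) P' → LTrans D Q.shift (.free (.inp (x + 1) 0)) Q' →
      LTrans D (.par P Q) (.free .tau) (.res (.par P' Q'))
  | closeR {P P' Q Q' : Proc S} {x : ℕ} :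
      LTrans D P.shift (.free (.inp (x + 1) 0)) P' → LTrans D Q (.bout x) Q' →
      LTrans D (.par P Q) (.free .tau) (.res (.par P' Q'))
  | res {P P' : Proc S} {a : FLabel} :
      LTrans D P (.free a.shift) P' → LTrans D (.res P) (.free a) (.res P')
  /-- In `P'` the extruded name is `0` and the restricted one is `1`; they are exchanged. -/
  | resBout {P P' : Proc S} {x : ℕ} :
      LTrans D P (.bout (x + 1)) P' → LTrans D (.res P) (.bout x) (.res (P'.rename swap01 id))
  | opening {P P' : Proc S} {x : ℕ} :
      LTrans D P (.free (.out (x + 1) 0)) P' → LTrans D (.res P) (.bout x) P'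
  | call {A : S.Const} {y : Fin (S.arity A) → ℕ} {μ : Label} {P' : Proc S} :
      LTrans D ((D.body A).substParams y) μ P' → LTrans D (.call A y) μ P'

/-- The alphabet `+₀, +₁, |₀, |₁` of the identifiers of Markovian transitions. -/
inductive Pos : Type
  | sum0
  | sum1
  | par0
  | par1

/-- Identified Markovian transitions: `MTrans D P r i P'` is the transition from `P` to `P'` with
rate `r` and identifier `i`. -/
inductive MTrans {S : Sig.{u}} (D : Env S) : Proc S → Rate → List Pos → Proc S → Prop
  | rate (r : Rate) (P : Proc S) : MTrans D (.sum (.pre (.rate r) P)) r [] P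
  | sumL {M : Summ S} {r : Rate} {i : List Pos} {P' : Proc S} (N : Summ S) :
      MTrans D (.sum M) r i P' → MTrans D (.sum (.plus M N)) r (Pos.sum0 :: i) P'
  | sumR {N : Summ S} {r : Rate} {i : List Pos} {P' : Proc S} (M : Summ S) :
      MTrans D (.sum N) r i P' → MTrans D (.sum (.plus M N)) r (Pos.sum1 :: i) P'
  | parL {P P' : Proc S} {r : Rate} {i : List Pos} (Q : Proc S) :
      MTrans D P r i P' → MTrans D (.par P Q) r (Pos.par0 :: i) (.par P' Q)
  | parR {Q Q' : Proc S} {r : Rate} {i : List Pos} (P : Proc S) :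
      MTrans D Q r i Q' → MTrans D (.par P Q) r (Pos.par1 :: i) (.par P Q')
  | res {P P' : Proc S} {r : Rate} {i : List Pos} :
      MTrans D P r i P' → MTrans D (.res P) r i (.res P')
  | call {A : S.Const} {y : Fin (S.arity A) → ℕ} {r : Rate} {i : List Pos} {P' : Proc S} :
      MTrans D ((D.body A).substParams y) r i P' → MTrans D (.call A y) r i P'

/-! ## Structural congruence -/

/-- Structural congruence: the smallest congruence on the terms of the extended calculus that
satisfies the laws.  The side conditions on free names are expressed by the shift operations. -/
inductive Cong {S : Sig.{u}} (D : Env S) : Proc S → Proc S → Prop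
  | refl (P : Proc S) : Cong D P P
  | symm {P Q : Proc S} : Cong D P Q → Cong D Q P
  | trans {P Q R : Proc S} : Cong D P Q → Cong D Q R → Cong D P R
  | parCongr {P P' Q Q' : Proc S} : Cong D P P' → Cong D Q Q' → Cong D (.par P Q) (.par P' Q')
  | resCongr {P P' : Proc S} : Cong D P P' → Cong D (.res P) (.res P')
  | sresCongr {P P' : Proc S} (r : Rate) : Cong D P P' → Cong D (.sres r P) (.sres r P')
  | preCongr {P P' : Proc S} (α : Prefix) :
      Cong D P P' → Cong D (.sum (.pre α P)) (.sum (.pre α P'))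
  | plusCongr {M M' N N' : Summ S} : Cong D (.sum M) (.sum M') → Cong D (.sum N) (.sum N') →
      Cong D (.sum (.plus M N)) (.sum (.plus M' N'))
  | resPar (P Q : Proc S) : Cong D (.par (.res P) Q) (.res (.par P Q.shift))
  | sresPar (r : Rate) (P Q : Proc S) :
      Cong D (.par (.sres r P) Q) (.sres r (.par P Q.sshift))
  | resRes (P : Proc S) : Cong D (.res (.res P)) (.res (.res (P.rename swap01 id)))
  | resSres (r : Rate) (P : Proc S) : Cong D (.res (.sres r P)) (.sres r (.res P))
  | sresSres (r s : Rate) (P : Proc S) :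
      Cong D (.sres r (.sres s P)) (.sres s (.sres r (P.rename id swap01)))
  | resNil : Cong D (.res .nil) .nil
  | sresNil (r : Rate) : Cong D (.sres r .nil) .nil
  | plusAssoc (M₁ M₂ M₃ : Summ S) :
      Cong D (.sum (.plus (.plus M₁ M₂) M₃)) (.sum (.plus M₁ (.plus M₂ M₃)))
  | plusComm (M N : Summ S) : Cong D (.sum (.plus M N)) (.sum (.plus N M))
  | plusNil (M : Summ S) : Cong D (.sum (.plus M .nil)) (.sum M)
  | parAssoc (P₁ P₂ P₃ : Proc S) : Cong D (.par (.par P₁ P₂) P₃) (.par P₁ (.par P₂ P₃))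
  | parComm (P Q : Proc S) : Cong D (.par P Q) (.par Q P)
  | parNil (P : Proc S) : Cong D (.par P .nil) P
  | call (A : S.Const) (y : Fin (S.arity A) → ℕ) :
      Cong D (.call A y) ((D.body A).substParams y)
  /-- `(r).P + M ≡ (ν q → r)((q).P + M)` for a stochastic name `q` that is free in neither
  `P` nor `M` -/
  | rate (r : Rate) (P : Proc S) (M : Summ S) :
      Cong D (.sum (.plus (.pre (.rate r) P) M))
        (.sres r (.sum (.plus (.pre (.delay 0) P.sshift) M.sshift)))

/-- Structural congruence as a setoid. -/
def congSetoid {S : Sig.{u}} (D : Env S) : Setoid (Proc S) where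
  r := Cong D
  iseqv := ⟨Cong.refl, Cong.symm, Cong.trans⟩

/-- The congruence classes of terms of the extended calculus. -/
def CongClass {S : Sig.{u}} (D : Env S) : Type u := Quotient (congSetoid D)

/-- The congruence class of a term. -/
def cls {S : Sig.{u}} (D : Env S) (P : Proc S) : CongClass D := Quotient.mk (congSetoid D) P

/-- The map `[P] ↦ [(ν q → r) P]` on congruence classes. -/
def sresClass {S : Sig.{u}} (D : Env S) (r : Rate) : CongClass D → CongClass D :=
  Quotient.map' (Proc.sres r) (fun _ _ h => Cong.sresCongr r h)

/-! ## Reduction semantics -/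

/-- Reductions (label `none`) and symbolically quantified delay transitions (label `some q`). -/
inductive Red {S : Sig.{u}} (D : Env S) : Option ℕ → Proc S → Proc S → Prop
  | delay (q : ℕ) (P : Proc S) (M : Summ S) :
      Red D (some q) (.sum (.plus (.pre (.delay q) P) M)) P
  | tau (P : Proc S) (M : Summ S) : Red D none (.sum (.plus (.pre .tau P) M)) P
  | comm (x y : ℕ) (P Q : Proc S) (M N : Summ S) :
      Red D none (.par (.sum (.plus (.pre (.inp x) P) M)) (.sum (.plus (.pre (.out x y) Q) N)))
        (.par (P.inst y) Q)
  | par {l : Option ℕ} {P P' : Proc S} (Q : Proc S) :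
      Red D l P P' → Red D l (.par P Q) (.par P' Q)
  | res {l : Option ℕ} {P P' : Proc S} : Red D l P P' → Red D l (.res P) (.res P')
  | sres {l : Option ℕ} {P P' : Proc S} (r : Rate) :
      Red D (l.map Nat.succ) P P' → Red D l (.sres r P) (.sres r P')
  | cong {l : Option ℕ} {P Q Q' P' : Proc S} :
      Cong D P Q → Red D l Q Q' → Cong D Q' P' → Red D l P P'

/-- Rate distributions over `X`: non-empty finite multisets of pairs of a rate and an element
of `X`. -/
def RDist (X : Type u) : Type u := {σ : Multiset (Rate × X) // σ ≠ 0}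

/-- The distribution with the single pair `(r, e)`. -/
def RDist.single {X : Type u} (r : Rate) (e : X) : RDist X :=
  ⟨{(r, e)}, Multiset.singleton_ne_zero _⟩

/-- The multiset union of `σ` and the distribution with the single pair `(r, e)`. -/
def RDist.add {X : Type u} (σ : RDist X) (r : Rate) (e : X) : RDist X :=
  ⟨σ.1 + {(r, e)}, by simp⟩

/-- The image of a rate distribution under a map of the underlying sets. -/
def RDist.map {X Y : Type u} (f : X → Y) (σ : RDist X) : RDist Y :=
  ⟨σ.1.map (fun p => (p.1, f p.2)), by simpa using σ.2⟩

open Classical in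
/-- The total rate that `σ` assigns to `e`: the sum over the distinct pairs `(r, e)` in `σ` of `r`
times the multiplicity of `(r, e)`. -/
noncomputable def RDist.rateTo {X : Type u} (σ : RDist X) (e : X) : ℝ :=
  ∑ p ∈ σ.1.toFinset with p.2 = e, (p.1 : ℝ) * (σ.1.count p : ℝ)

/-- The rules for stochastic transitions, where `N P` is the reading of the negative premise
"`P` has no stochastic transition". -/
inductive StoRules {S : Sig.{u}} (D : Env S) (N : Proc S → Prop) :
    Proc S → RDist (CongClass D) → Prop
  | sto1 {P P' : Proc S} {σ : RDist (CongClass D)} (r : Rate) :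
      StoRules D N P σ → Red D (some 0) P P' →
      StoRules D N (.sres r P) ((σ.map (sresClass D r)).add r (cls D (.sres r P')))
  | sto2 {P P' : Proc S} (r : Rate) : N P → Red D (some 0) P P' →
      StoRules D N (.sres r P) (RDist.single r (cls D (.sres r P')))
  | cong {P Q : Proc S} {σ : RDist (CongClass D)} :
      Cong D P Q → StoRules D N Q σ → StoRules D N P σ

/-- `P` is congruent to a term `(ν q → r) Q` such that `Q` has a delay transition with label `q`. -/
def ActiveBinder {S : Sig.{u}} (D : Env S) (P : Proc S) : Prop :=
  ∃ r Q Q', Cong D P (.sres r Q) ∧ Red D (some 0) Q Q'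

/-- Stochastic transitions.  The first stratum (which terms have a stochastic transition at all)
is `ActiveBinder`; by `sto_iff` and `sto_unique` below, `Sto D` is the one and only relation that
is generated by the rules when their negative premise is read in that relation itself. -/
def Sto {S : Sig.{u}} (D : Env S) : Proc S → RDist (CongClass D) → Prop :=
  StoRules D (fun P => ¬ ActiveBinder D P)

theorem StoRules.activeBinder {S : Sig.{u}} {D : Env S} {N : Proc S → Prop} {P : Proc S}
    {σ : RDist (CongClass D)} (h : StoRules D N P σ) : ActiveBinder D P := by
  induction h with
  | sto1 r _ h _ => exact ⟨r, _, _, Cong.refl _, h⟩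
  | sto2 r _ h => exact ⟨r, _, _, Cong.refl _, h⟩
  | cong h _ ih =>
    obtain ⟨r, Q, Q', h₁, h₂⟩ := ih
    exact ⟨r, Q, Q', Cong.trans h h₁, h₂⟩

/-- A relation that is generated by the rules, with the negative premise read in that relation
itself, relates exactly the terms with an active binder to some distribution. -/
theorem exists_iff_activeBinder {S : Sig.{u}} {D : Env S}
    {R : Proc S → RDist (CongClass D) → Prop}
    (hR : ∀ P σ, R P σ ↔ StoRules D (fun Q => ¬ ∃ σ', R Q σ') P σ) (P : Proc S) :
    (∃ σ, R P σ) ↔ ActiveBinder D P := by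
  constructor
  · rintro ⟨σ, h⟩
    exact ((hR P σ).1 h).activeBinder
  · rintro ⟨r, Q, Q', h₁, h₂⟩
    by_cases hQ : ∃ σ, R Q σ
    · obtain ⟨σ, hσ⟩ := hQ
      exact ⟨_, (hR _ _).2 (.cong h₁ (.sto1 r ((hR _ _).1 hσ) h₂))⟩
    · exact ⟨_, (hR _ _).2 (.cong h₁ (.sto2 r hQ h₂))⟩

/-! The remaining facts show that the negative premise is well founded: the number of unguarded
delays that are not symbolic with a free name is finite, invariant under congruence, and drops
when an active binder is removed. -/

/-- Number of unguarded prefixes `(q)` in a summation. -/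
def Summ.free {S : Sig.{u}} (q : ℕ) : Summ S → ℕ
  | .nil => 0
  | .pre (.delay q') _ => if q' = q then 1 else 0
  | .pre _ _ => 0
  | .plus M N => M.free q + N.free q

/-- Number of unguarded prefixes `(r)` with a numerical rate in a summation. -/
def Summ.closed {S : Sig.{u}} : Summ S → ℕ
  | .nil => 0
  | .pre (.rate _) _ => 1
  | .pre _ _ => 0
  | .plus M N => M.closed + N.closed

/-- Number of unguarded free prefixes `(q)`. -/
def Proc.free {S : Sig.{u}} : ℕ → Proc S → ℕ
  | q, .sum M => M.free q
  | q, .par P Q => P.free q + Q.free q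
  | q, .res P => P.free q
  | q, .sres _ P => P.free (q + 1)
  | _, .call _ _ => 0

/-- Number of unguarded delays that are numerical or bound by a stochastic binder, if `v` gives
these numbers for the constants. -/
def Proc.closed {S : Sig.{u}} (v : S.Const → ℕ) : Proc S → ℕ
  | .sum M => M.closed
  | .par P Q => P.closed v + Q.closed v
  | .res P => P.closed v
  | .sres _ P => P.closed v + P.free 0
  | .call A _ => v A

/-- The constants that occur unguarded. -/
def Proc.heads {S : Sig.{u}} : Proc S → Set S.Const
  | .sum _ => ∅
  | .par P Q => P.heads ∪ Q.heads
  | .res P => P.heads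
  | .sres _ P => P.heads
  | .call A _ => {A}

section Count

variable {S : Sig.{u}}

theorem up_injective {κ : ℕ → ℕ} (h : Function.Injective κ) : Function.Injective (up κ) := by
  rintro (_ | a) (_ | b) hab <;> simp_all [up]
  exact h hab

theorem swap01_injective : Function.Injective swap01 := by
  rintro (_ | _ | a) (_ | _ | b) hab <;> simp_all [swap01]

theorem Summ.free_rename (ρ : ℕ → ℕ) {κ : ℕ → ℕ} (h : Function.Injective κ) (q : ℕ) :
    ∀ M : Summ S, (M.rename ρ κ).free (κ q) = M.free q
  | .nil => rfl
  | .pre α P => by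
    cases α <;> simp [Summ.rename, Prefix.rename, Summ.free, h.eq_iff]
  | .plus M N => by
    simp [Summ.rename, Summ.free, Summ.free_rename ρ h q M, Summ.free_rename ρ h q N]

theorem Summ.free_rename_zero (ρ : ℕ → ℕ) {κ : ℕ → ℕ} {q : ℕ} (h : ∀ n, κ n ≠ q) :
    ∀ M : Summ S, (M.rename ρ κ).free q = 0
  | .nil => rfl
  | .pre α P => by
    cases α <;> simp [Summ.rename, Prefix.rename, Summ.free, h]
  | .plus M N => by
    simp [Summ.rename, Summ.free, Summ.free_rename_zero ρ h M, Summ.free_rename_zero ρ h N]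

theorem Summ.closed_rename (ρ κ : ℕ → ℕ) : ∀ M : Summ S, (M.rename ρ κ).closed = M.closed
  | .nil => rfl
  | .pre α P => by
    cases α <;> simp [Summ.rename, Prefix.rename, Summ.closed]
  | .plus M N => by
    simp [Summ.rename, Summ.closed, Summ.closed_rename ρ κ M, Summ.closed_rename ρ κ N]

theorem Summ.free_plain (q : ℕ) : ∀ M : Summ S, M.Plain → M.free q = 0
  | .nil, _ => rfl
  | .pre α P, h => by
    cases α <;> simp_all [Summ.Plain, Prefix.Plain, Summ.free]
  | .plus M N, h => by
    simp only [Summ.Plain] at h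
    simp [Summ.free, Summ.free_plain q M h.1, Summ.free_plain q N h.2]

theorem Proc.free_rename : ∀ (P : Proc S) (ρ : ℕ → ℕ) {κ : ℕ → ℕ} (_ : Function.Injective κ)
    (q : ℕ), (P.rename ρ κ).free (κ q) = P.free q
  | .sum M, ρ, κ, h, q => by simp [Proc.rename, Proc.free, Summ.free_rename ρ h]
  | .par P Q, ρ, κ, h, q => by
    simp [Proc.rename, Proc.free, Proc.free_rename P ρ h, Proc.free_rename Q ρ h]
  | .res P, ρ, κ, h, q => by simp [Proc.rename, Proc.free, Proc.free_rename P _ h]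
  | .sres r P, ρ, κ, h, q => by
    simpa [Proc.rename, Proc.free, up] using Proc.free_rename P ρ (up_injective h) (q + 1)
  | .call A y, ρ, κ, h, q => by simp [Proc.rename, Proc.free]

theorem Proc.free_rename_zero : ∀ (P : Proc S) (ρ : ℕ → ℕ) {κ : ℕ → ℕ} {q : ℕ}
    (_ : ∀ n, κ n ≠ q), (P.rename ρ κ).free q = 0
  | .sum M, ρ, κ, q, h => by simp [Proc.rename, Proc.free, Summ.free_rename_zero ρ h]
  | .par P Q, ρ, κ, q, h => by
    simp [Proc.rename, Proc.free, Proc.free_rename_zero P ρ h, Proc.free_rename_zero Q ρ h]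
  | .res P, ρ, κ, q, h => by simp [Proc.rename, Proc.free, Proc.free_rename_zero P _ h]
  | .sres r P, ρ, κ, q, h => by
    refine Proc.free_rename_zero P ρ ?_
    rintro (_ | n)
    · simp [up]
    · simpa [up] using h n
  | .call A y, ρ, κ, q, h => by simp [Proc.rename, Proc.free]

theorem Proc.closed_rename (v : S.Const → ℕ) : ∀ (P : Proc S) (ρ : ℕ → ℕ) {κ : ℕ → ℕ}
    (_ : Function.Injective κ), (P.rename ρ κ).closed v = P.closed v
  | .sum M, ρ, κ, h => by simp [Proc.rename, Proc.closed, Summ.closed_rename]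
  | .par P Q, ρ, κ, h => by
    simp [Proc.rename, Proc.closed, Proc.closed_rename v P ρ h, Proc.closed_rename v Q ρ h]
  | .res P, ρ, κ, h => by simp [Proc.rename, Proc.closed, Proc.closed_rename v P _ h]
  | .sres r P, ρ, κ, h => by
    have := Proc.free_rename P ρ (up_injective h) 0
    simp only [up] at this
    simp [Proc.rename, Proc.closed, Proc.closed_rename v P ρ (up_injective h), this]
  | .call A y, ρ, κ, h => by simp [Proc.rename, Proc.closed]

theorem Proc.free_plain : ∀ (P : Proc S) (q : ℕ), P.Plain → P.free q = 0
  | .sum M, q, h => by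
    simp only [Proc.Plain] at h
    simp [Proc.free, Summ.free_plain q M h]
  | .par P Q, q, h => by
    simp only [Proc.Plain] at h
    simp [Proc.free, Proc.free_plain P q h.1, Proc.free_plain Q q h.2]
  | .res P, q, h => by
    simp only [Proc.Plain] at h
    simp [Proc.free, Proc.free_plain P q h]
  | .sres r P, q, h => by simp [Proc.Plain] at h
  | .call A y, q, h => by simp [Proc.free]

theorem Cong.count_eq {D : Env S} {v : S.Const → ℕ} (hv : ∀ A, v A = (D.body A).closed v)
    {P Q : Proc S} (h : Cong D P Q) :
    (∀ q, P.free q = Q.free q) ∧ P.closed v = Q.closed v := by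
  have hid : Function.Injective (id : ℕ → ℕ) := Function.injective_id
  induction h with
  | refl P => exact ⟨fun _ => rfl, rfl⟩
  | symm _ ih => exact ⟨fun q => (ih.1 q).symm, ih.2.symm⟩
  | trans _ _ ih₁ ih₂ => exact ⟨fun q => (ih₁.1 q).trans (ih₂.1 q), ih₁.2.trans ih₂.2⟩
  | parCongr _ _ ih₁ ih₂ => simp [Proc.free, Proc.closed, ih₁.1, ih₂.1, ih₁.2, ih₂.2]
  | resCongr _ ih => simp [Proc.free, Proc.closed, ih.1, ih.2]
  | sresCongr r _ ih => simp [Proc.free, Proc.closed, ih.1, ih.2]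
  | preCongr α _ ih => cases α <;> simp [Proc.free, Proc.closed, Summ.free, Summ.closed]
  | plusCongr _ _ ih₁ ih₂ =>
    simp only [Proc.free, Proc.closed] at ih₁ ih₂
    simp [Proc.free, Proc.closed, Summ.free, Summ.closed, ih₁.1, ih₂.1, ih₁.2, ih₂.2]
  | resPar P Q =>
    refine ⟨fun q => ?_, ?_⟩
    · have := Proc.free_rename Q Nat.succ hid q
      simp only [id] at this
      simp [Proc.free, Proc.shift, this]
    · simp [Proc.closed, Proc.shift, Proc.closed_rename v Q Nat.succ hid]
  | sresPar r P Q =>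
    refine ⟨fun q => ?_, ?_⟩
    · have := Proc.free_rename Q id Nat.succ_injective q
      simp only [Nat.succ_eq_add_one] at this
      simp [Proc.free, Proc.sshift, this]
    · have := Proc.free_rename_zero Q id (κ := Nat.succ) (q := 0) (fun n => Nat.succ_ne_zero n)
      simp [Proc.closed, Proc.free, Proc.sshift, this,
        Proc.closed_rename v Q id Nat.succ_injective]
      omega
  | resRes P =>
    refine ⟨fun q => ?_, ?_⟩
    · have := Proc.free_rename P swap01 hid q
      simp only [id] at this
      simp [Proc.free, this]
    · simp [Proc.closed, Proc.closed_rename v P swap01 hid]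
  | resSres r P => simp [Proc.free, Proc.closed]
  | sresSres r s P =>
    refine ⟨fun q => ?_, ?_⟩
    · have := Proc.free_rename P id swap01_injective (q + 2)
      simp only [swap01] at this
      simp [Proc.free, this]
    · have h0 := Proc.free_rename P id swap01_injective 0
      have h1 := Proc.free_rename P id swap01_injective 1
      simp only [swap01] at h0 h1
      simp [Proc.closed, Proc.free, h0, h1, Proc.closed_rename v P id swap01_injective]
      omega
  | resNil => simp [Proc.free, Proc.closed, Proc.nil]
  | sresNil r => simp [Proc.free, Proc.closed, Proc.nil, Summ.free]
  | plusAssoc M₁ M₂ M₃ =>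
    simp [Proc.free, Proc.closed, Summ.free, Summ.closed, add_assoc]
  | plusComm M N => simp [Proc.free, Proc.closed, Summ.free, Summ.closed, add_comm]
  | plusNil M => simp [Proc.free, Proc.closed, Summ.free, Summ.closed]
  | parAssoc P₁ P₂ P₃ => simp [Proc.free, Proc.closed, add_assoc]
  | parComm P Q => simp [Proc.free, Proc.closed, add_comm]
  | parNil P => simp [Proc.free, Proc.closed, Proc.nil, Summ.free, Summ.closed]
  | call A y =>
    refine ⟨fun q => ?_, ?_⟩
    · have := Proc.free_rename (D.body A)
        (fun i => if h : i < S.arity A then y ⟨i, h⟩ else i) hid q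
      simp only [id] at this
      simp only [Proc.free, Proc.substParams]
      exact (this.trans (Proc.free_plain _ q (D.plain A))).symm
    · simp [Proc.closed, Proc.substParams, Proc.closed_rename v _ _ hid, ← hv A]
  | rate r P M =>
    refine ⟨fun q => ?_, ?_⟩
    · have := Summ.free_rename id Nat.succ_injective q M
      simp only [Nat.succ_eq_add_one] at this
      simp [Proc.free, Summ.free, Summ.sshift, this]
    · have := Summ.free_rename_zero id (κ := Nat.succ) (q := 0) (fun n => Nat.succ_ne_zero n) M
      simp [Proc.closed, Proc.free, Summ.free, Summ.closed, Summ.sshift, this,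
        Summ.closed_rename]
      omega

theorem Red.free_pos {D : Env S} {v : S.Const → ℕ} (hv : ∀ A, v A = (D.body A).closed v)
    {l : Option ℕ} {P P' : Proc S} (h : Red D l P P') : ∀ q, l = some q → 0 < P.free q := by
  induction h with
  | delay q P M =>
    rintro _ ⟨⟩
    simp only [Proc.free, Summ.free, if_true]
    omega
  | tau => simp
  | comm => simp
  | par Q _ ih =>
    intro q hq
    have := ih q hq
    simp only [Proc.free]
    omega
  | res _ ih => exact ih
  | sres r _ ih =>
    rintro q rfl
    exact ih (q + 1) rfl
  | cong h _ _ ih =>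
    intro q hq
    rw [(Cong.count_eq hv h).1 q]
    exact ih q hq

theorem Proc.closed_congr {v w : S.Const → ℕ} : ∀ P : Proc S,
    (∀ A ∈ P.heads, v A = w A) → P.closed v = P.closed w
  | .sum M, _ => rfl
  | .par P Q, h => by
    simp only [Proc.heads, Set.mem_union] at h
    simp [Proc.closed, Proc.closed_congr P fun A hA => h A (.inl hA),
      Proc.closed_congr Q fun A hA => h A (.inr hA)]
  | .res P, h => Proc.closed_congr P h
  | .sres r P, h => by
    simp only [Proc.closed]
    rw [Proc.closed_congr P h]
  | .call A y, h => h A rfl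

theorem Proc.heads_rename : ∀ (P : Proc S) (ρ κ : ℕ → ℕ), (P.rename ρ κ).heads = P.heads
  | .sum M, _, _ => rfl
  | .par P Q, ρ, κ => by
    simp [Proc.rename, Proc.heads, Proc.heads_rename P, Proc.heads_rename Q]
  | .res P, ρ, κ => Proc.heads_rename P _ _
  | .sres r P, ρ, κ => Proc.heads_rename P _ _
  | .call A y, _, _ => rfl

theorem Proc.heads_of_guarded : ∀ P : Proc S, P.Guarded → P.heads = ∅
  | .sum M, _ => rfl
  | .par P Q, h => by
    simp only [Proc.Guarded] at h
    simp [Proc.heads, Proc.heads_of_guarded P h.1, Proc.heads_of_guarded Q h.2]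
  | .res P, h => Proc.heads_of_guarded P h
  | .sres r P, h => Proc.heads_of_guarded P h
  | .call A y, h => by simp [Proc.Guarded] at h

theorem Unfold.heads {body : S.Const → Proc S} {P P' : Proc S} (h : Unfold body P P') :
    ∀ A ∈ P.heads, A ∈ P'.heads ∨ (body A).heads ⊆ P'.heads := by
  induction h with
  | call A y =>
    intro B hB
    rw [show B = A from hB]
    right
    simp [Proc.substParams, Proc.heads_rename]
  | parL Q _ ih =>
    rintro A (hA | hA)
    · exact (ih A hA).imp .inl fun h => h.trans Set.subset_union_left
    · exact .inl (.inr hA)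
  | parR P _ ih =>
    rintro A (hA | hA)
    · exact .inl (.inl hA)
    · exact (ih A hA).imp .inr fun h => h.trans Set.subset_union_right
  | res _ ih => exact ih
  | sres r _ ih => exact ih
  | pre α _ _ => exact fun A hA => hA.elim
  | plusL N _ _ => exact fun A hA => hA.elim
  | plusR M _ _ => exact fun A hA => hA.elim

/-- Weak guardedness: unguarded occurrence of constants in defining terms is well founded. -/
theorem Env.wf (D : Env S) : WellFounded fun B A => B ∈ (D.body A).heads := by
  refine ⟨fun A => ⟨A, ?_⟩⟩
  obtain ⟨P', h, hg⟩ := D.guarded A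
  suffices ∀ B ∈ (D.body A).heads, Acc (fun B A => B ∈ (D.body A).heads) B from this
  generalize D.body A = P at h
  induction h using Relation.ReflTransGen.head_induction_on with
  | refl =>
    intro B hB
    simp [Proc.heads_of_guarded P' hg] at hB
  | head h _ ih =>
    intro B hB
    rcases h.heads B hB with h | h
    · exact ih B h
    · exact ⟨B, fun C hC => ih C (h hC)⟩

open Classical in
theorem Env.exists_count (D : Env S) : ∃ v : S.Const → ℕ, ∀ A, v A = (D.body A).closed v := by
  refine ⟨D.wf.fix fun A ih =>
    (D.body A).closed fun B => if h : B ∈ (D.body A).heads then ih B h else 0, fun A => ?_⟩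
  rw [WellFounded.fix_eq]
  refine Proc.closed_congr _ fun B hB => ?_
  simp [hB]

end Count

theorem exists_sto_iff {S : Sig.{u}} (D : Env S) (P : Proc S) :
    (∃ σ, Sto D P σ) ↔ ActiveBinder D P := by
  refine ⟨fun ⟨_, h⟩ => StoRules.activeBinder h, fun h => ?_⟩
  obtain ⟨v, hv⟩ := D.exists_count
  generalize hn : P.closed v = n
  induction n using Nat.strong_induction_on generalizing P with
  | _ n ih =>
    obtain ⟨r, Q, Q', h₁, h₂⟩ := h
    by_cases hQ : ActiveBinder D Q
    · have hlt : Q.closed v < n := by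
        have h₃ := (Cong.count_eq hv h₁).2
        have h₄ := h₂.free_pos hv 0 rfl
        simp only [Proc.closed] at h₃
        omega
      obtain ⟨σ, hσ⟩ := ih _ hlt Q hQ rfl
      exact ⟨_, StoRules.cong h₁ (.sto1 r hσ h₂)⟩
    · exact ⟨_, StoRules.cong h₁ (.sto2 r hQ h₂)⟩

/-- `Sto D` is generated by the rules, with the negative premise read literally. -/
theorem sto_iff {S : Sig.{u}} (D : Env S) (P : Proc S) (σ : RDist (CongClass D)) :
    Sto D P σ ↔ StoRules D (fun Q => ¬ ∃ σ', Sto D Q σ') P σ := by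
  simp only [exists_sto_iff]
  rfl

/-- `Sto D` is the only relation that is generated by the rules in this sense. -/
theorem sto_unique {S : Sig.{u}} (D : Env S) (R : Proc S → RDist (CongClass D) → Prop)
    (hR : ∀ P σ, R P σ ↔ StoRules D (fun Q => ¬ ∃ σ', R Q σ') P σ) : R = Sto D := by
  funext P σ
  have h := hR P σ
  simp only [exists_iff_activeBinder hR] at h
  exact propext h

/-- The labeled Markovian transitions, as triples of a rate, an identifier and a target, of `P`
into terms congruent to `P'`. -/
def markovInto {S : Sig.{u}} (D : Env S) (P P' : Proc S) : Set (Rate × List Pos × Proc S) :=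
  {t | MTrans D P t.1 t.2.1 t.2.2 ∧ Cong D t.2.2 P'}

end MPi

-- Both halves rest on an invariant of structural congruence that is defined on all extended terms.
-- It has to be, because a congruence, reduction or stochastic derivation that starts from a plain
-- term may run through terms with stochastic binders.
--
-- For reductions the mediator is the relation `Late`: a late transition system that also passes
-- through stochastic binders. The target of a late input keeps its name bound, so transitions are
-- preserved by every renaming and reflected by injective ones (`Late.rename`, `Late.of_rename`),
-- and the scope laws need exactly this. Structural congruence is then a bisimulation up to itself
-- (`Cong.simulated`), so every reduction is a late silent transition (`Red.exists_late`).
-- Conversely, the laws of choice bring the active summand to the front. An output is driven towards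
-- a parallel input summation by induction on its own derivation (`Late.red_out_inputSum`,
-- `Late.red_bout_inputSum`). An induction on the input side (`Late.red_comm`, `Late.red_close`)
-- then shows that late silent transitions are reductions (`Late.red`). On plain terms, late and
-- early silent transitions coincide (`ltrans_tau_iff_late`).
--
-- For rates the mediator is `Proc.delays`: the finite multiset of unguarded delays, each recorded
-- with its kind (a rate or a free stochastic name) and the congruence class of its target in
-- context. Weak guardedness makes it definable through constants (`Env.exists_delayEnv`). It is
-- invariant under congruence (`Cong.delays_eq`), the law for `(r)` being respected because a binder
-- converts the name it binds into its rate. On plain terms it lists the Markovian transitions one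
-- by one, since identifiers keep different occurrences apart (`Proc.exists_enumerates`).
--
-- A stochastic rule emits one pair per active binder, even if that binder binds several delays. A
-- distribution can therefore miss some rated delays unless no unguarded binder binds two of them.
-- This is `Proc.Affine`; plain terms satisfy it, and it is invariant under congruence
-- (`Cong.affine_iff`). For such terms every distribution equals the multiset of rated delays
-- (`Sto.eq_delays`). The negative premise loses nothing, because a rated delay always yields an
-- active binder (`Proc.activeBinder_of_mem_delays`). Comparing the two descriptions of
-- `Proc.delays` on a plain term gives the equality of rates.

namespace MPi

-- Algebra of renamings, and congruence under renaming.

section Renaming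

variable {S : Sig.{u}}

theorem up_comp (ρ ρ' : ℕ → ℕ) : up ρ' ∘ up ρ = up (ρ' ∘ ρ) := by
  funext n; cases n <;> rfl

theorem up_id : up id = id := by
  funext n; cases n <;> rfl

theorem up_comp_succ (ρ : ℕ → ℕ) : up ρ ∘ Nat.succ = Nat.succ ∘ ρ := rfl

theorem swap01_comp_swap01 : swap01 ∘ swap01 = id := by
  funext n; rcases n with _ | _ | n <;> rfl

theorem swap01_comp_succ : swap01 ∘ Nat.succ = up Nat.succ := by
  funext n; rcases n with _ | n <;> rfl

theorem swap01_comp_up_succ : swap01 ∘ up Nat.succ = Nat.succ := by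
  funext n; rcases n with _ | n <;> rfl

theorem swap01_comp_up_up (ρ : ℕ → ℕ) : swap01 ∘ up (up ρ) = up (up ρ) ∘ swap01 := by
  funext n; rcases n with _ | _ | n <;> rfl

theorem instMap_comp_succ (w : ℕ) : instMap w ∘ Nat.succ = id := rfl

theorem instMap_zero_comp_up_succ : instMap 0 ∘ up Nat.succ = id := by
  funext n; cases n <;> rfl

theorem comp_instMap (ρ : ℕ → ℕ) (w : ℕ) : ρ ∘ instMap w = instMap (ρ w) ∘ up ρ := by
  funext n; cases n <;> rfl

theorem up_instMap_comp_swap01 (w : ℕ) : up (instMap w) ∘ swap01 = instMap (w + 1) := by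
  funext n; rcases n with _ | _ | n <;> rfl

theorem Prefix.rename_rename (α : Prefix) (ρ κ ρ' κ' : ℕ → ℕ) :
    (α.rename ρ κ).rename ρ' κ' = α.rename (ρ' ∘ ρ) (κ' ∘ κ) := by
  cases α <;> rfl

theorem Prefix.rename_id (α : Prefix) : α.rename id id = α := by
  cases α <;> rfl

theorem Prefix.under_comp (α : Prefix) (ρ κ ρ' : ℕ → ℕ) :
    (α.rename ρ κ).under ρ' ∘ α.under ρ = α.under (ρ' ∘ ρ) := by
  cases α <;> simp [Prefix.under, Prefix.rename, up_comp]

theorem Prefix.under_id (α : Prefix) : α.under id = id := by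
  cases α <;> simp [Prefix.under, up_id]

mutual

theorem Proc.rename_rename : ∀ (P : Proc S) (ρ κ ρ' κ' : ℕ → ℕ),
    (P.rename ρ κ).rename ρ' κ' = P.rename (ρ' ∘ ρ) (κ' ∘ κ)
  | .sum M, ρ, κ, ρ', κ' => by simp [Proc.rename, Summ.rename_rename M]
  | .par P Q, ρ, κ, ρ', κ' => by
    simp [Proc.rename, Proc.rename_rename P, Proc.rename_rename Q]
  | .res P, ρ, κ, ρ', κ' => by simp [Proc.rename, Proc.rename_rename P, up_comp]
  | .sres r P, ρ, κ, ρ', κ' => by simp [Proc.rename, Proc.rename_rename P, up_comp]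
  | .call A y, ρ, κ, ρ', κ' => by simp [Proc.rename]

theorem Summ.rename_rename : ∀ (M : Summ S) (ρ κ ρ' κ' : ℕ → ℕ),
    (M.rename ρ κ).rename ρ' κ' = M.rename (ρ' ∘ ρ) (κ' ∘ κ)
  | .nil, ρ, κ, ρ', κ' => rfl
  | .pre α P, ρ, κ, ρ', κ' => by
    simp [Summ.rename, Proc.rename_rename P, Prefix.rename_rename, Prefix.under_comp]
  | .plus M N, ρ, κ, ρ', κ' => by
    simp [Summ.rename, Summ.rename_rename M, Summ.rename_rename N]

end

mutual

theorem Proc.rename_id : ∀ P : Proc S, P.rename id id = P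
  | .sum M => by simp [Proc.rename, Summ.rename_id M]
  | .par P Q => by simp [Proc.rename, Proc.rename_id P, Proc.rename_id Q]
  | .res P => by simp [Proc.rename, Proc.rename_id P, up_id]
  | .sres r P => by simp [Proc.rename, Proc.rename_id P, up_id]
  | .call A y => by simp [Proc.rename]

theorem Summ.rename_id : ∀ M : Summ S, M.rename id id = M
  | .nil => rfl
  | .pre α P => by
    simp [Summ.rename, Proc.rename_id P, Prefix.rename_id, Prefix.under_id]
  | .plus M N => by simp [Summ.rename, Summ.rename_id M, Summ.rename_id N]

end

theorem up_eq_of_eq {s : Set ℕ} {ρ ρ' : ℕ → ℕ} (h : ∀ n, n + 1 ∈ s → ρ n = ρ' n) :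
    ∀ n ∈ s, up ρ n = up ρ' n := by
  rintro (_ | n) hn
  · rfl
  · simp [up, h n hn]

mutual

/-- The renaming of a plain term depends only on the free channel names of the term. -/
theorem Proc.rename_congr_of_plain : ∀ (P : Proc S) (ρ ρ' κ κ' : ℕ → ℕ), P.Plain →
    (∀ n ∈ P.fn, ρ n = ρ' n) → P.rename ρ κ = P.rename ρ' κ'
  | .sum M, ρ, ρ', κ, κ', hP, h => by
    simp only [Proc.rename, Summ.rename_congr_of_plain M ρ ρ' κ κ' hP h]
  | .par P Q, ρ, ρ', κ, κ', hP, h => by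
    simp only [Proc.Plain] at hP
    simp only [Proc.fn, Set.mem_union] at h
    simp only [Proc.rename,
      Proc.rename_congr_of_plain P ρ ρ' κ κ' hP.1 fun n hn => h n (.inl hn),
      Proc.rename_congr_of_plain Q ρ ρ' κ κ' hP.2 fun n hn => h n (.inr hn)]
  | .res P, ρ, ρ', κ, κ', hP, h => by
    simp only [Proc.rename, Proc.rename_congr_of_plain P (up ρ) (up ρ') κ κ' hP (up_eq_of_eq h)]
  | .sres r P, _, _, _, _, hP, _ => hP.elim
  | .call A y, ρ, ρ', κ, κ', hP, h => by
    simp only [Proc.rename]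
    congr 1
    funext i
    exact h _ ⟨i, rfl⟩

theorem Summ.rename_congr_of_plain : ∀ (M : Summ S) (ρ ρ' κ κ' : ℕ → ℕ), M.Plain →
    (∀ n ∈ M.fn, ρ n = ρ' n) → M.rename ρ κ = M.rename ρ' κ'
  | .nil, _, _, _, _, _, _ => rfl
  | .pre α P, ρ, ρ', κ, κ', hP, h => by
    simp only [Summ.Plain] at hP
    have key : α.rename ρ κ = α.rename ρ' κ' ∧ ∀ n ∈ P.fn, α.under ρ n = α.under ρ' n := by
      cases α with
      | out x y =>
        simp only [Summ.fn, Prefix.fn, Set.mem_union] at h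
        exact ⟨by simp [Prefix.rename, h x (.inl (.inl rfl)), h y (.inl (.inr rfl))],
          fun n hn => h n (.inr hn)⟩
      | inp x =>
        simp only [Summ.fn, Prefix.fn, Set.mem_union] at h
        exact ⟨by simp [Prefix.rename, h x (.inl rfl)], up_eq_of_eq fun n hn => h n (.inr hn)⟩
      | tau => exact ⟨rfl, h⟩
      | rate r => exact ⟨rfl, h⟩
      | delay q => exact hP.1.elim
    simp only [Summ.rename, key.1, Proc.rename_congr_of_plain P _ _ κ κ' hP.2 key.2]
  | .plus M N, ρ, ρ', κ, κ', hP, h => by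
    simp only [Summ.Plain] at hP
    simp only [Summ.fn, Set.mem_union] at h
    simp only [Summ.rename,
      Summ.rename_congr_of_plain M ρ ρ' κ κ' hP.1 fun n hn => h n (.inl hn),
      Summ.rename_congr_of_plain N ρ ρ' κ κ' hP.2 fun n hn => h n (.inr hn)]

end

mutual

theorem Proc.Plain.rename : ∀ {P : Proc S} (ρ κ : ℕ → ℕ), P.Plain → (P.rename ρ κ).Plain
  | .sum _, ρ, κ, h => Summ.Plain.rename ρ κ h
  | .par _ _, ρ, κ, h => by
    simp only [Proc.Plain] at h
    exact ⟨h.1.rename ρ κ, h.2.rename ρ κ⟩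
  | .res P, ρ, κ, h => Proc.Plain.rename (P := P) (up ρ) κ h
  | .sres _ _, _, _, h => h.elim
  | .call _ _, _, _, _ => trivial

theorem Summ.Plain.rename : ∀ {M : Summ S} (ρ κ : ℕ → ℕ), M.Plain → (M.rename ρ κ).Plain
  | .nil, _, _, _ => trivial
  | .pre α P, ρ, κ, h => by
    simp only [Summ.Plain] at h
    exact ⟨by cases α <;> simp_all [Prefix.rename, Prefix.Plain], h.2.rename _ κ⟩
  | .plus _ _, ρ, κ, h => by
    simp only [Summ.Plain] at h
    exact ⟨h.1.rename ρ κ, h.2.rename ρ κ⟩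

end

/-- A defining term has no free names besides its parameters and no stochastic names, so a renaming
can only act through the arguments. -/
theorem Env.substParams_rename (D : Env S) (A : S.Const) (y : Fin (S.arity A) → ℕ)
    (ρ κ : ℕ → ℕ) :
    ((D.body A).substParams y).rename ρ κ = (D.body A).substParams fun i => ρ (y i) := by
  rw [Proc.substParams, Proc.rename_rename]
  refine Proc.rename_congr_of_plain _ _ _ _ _ (D.plain A) fun n hn => ?_
  simp [D.fn_body A n hn]

theorem Env.substParams_plain (D : Env S) (A : S.Const) (y : Fin (S.arity A) → ℕ) :
    ((D.body A).substParams y).Plain := (D.plain A).rename _ _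

theorem Proc.shift_rename (P : Proc S) (ρ κ : ℕ → ℕ) :
    P.shift.rename (up ρ) κ = (P.rename ρ κ).shift := by
  simp [Proc.shift, Proc.rename_rename, up_comp_succ]

theorem Proc.sshift_rename (P : Proc S) (ρ κ : ℕ → ℕ) :
    P.sshift.rename ρ (up κ) = (P.rename ρ κ).sshift := by
  simp [Proc.sshift, Proc.rename_rename, up_comp_succ]

theorem Summ.sshift_rename (M : Summ S) (ρ κ : ℕ → ℕ) :
    M.sshift.rename ρ (up κ) = (M.rename ρ κ).sshift := by
  simp [Summ.sshift, Summ.rename_rename, up_comp_succ]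

theorem Proc.inst_rename (P : Proc S) (w : ℕ) (ρ κ : ℕ → ℕ) :
    (P.inst w).rename ρ κ = (P.rename (up ρ) κ).inst (ρ w) := by
  simp [Proc.inst, Proc.rename_rename, comp_instMap]

theorem Proc.shift_inst (P : Proc S) (w : ℕ) : P.shift.inst w = P := by
  simp [Proc.shift, Proc.inst, Proc.rename_rename, instMap_comp_succ, Proc.rename_id]

theorem Proc.rename_swap01_rename (P : Proc S) (ρ κ : ℕ → ℕ) :
    (P.rename swap01 id).rename (up (up ρ)) κ = (P.rename (up (up ρ)) κ).rename swap01 id := by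
  simp [Proc.rename_rename, swap01_comp_up_up]

theorem Proc.rename_swap01_swap01 (P : Proc S) :
    (P.rename swap01 id).rename swap01 id = P := by
  simp [Proc.rename_rename, swap01_comp_swap01, Proc.rename_id]

theorem Proc.shift_rename_swap01 (P : Proc S) :
    P.shift.rename swap01 id = P.rename (up Nat.succ) id := by
  simp [Proc.shift, Proc.rename_rename, swap01_comp_succ]

theorem Proc.rename_up_succ_swap01 (P : Proc S) :
    (P.rename (up Nat.succ) id).rename swap01 id = P.shift := by
  simp [Proc.shift, Proc.rename_rename, swap01_comp_up_succ]

/-- Shifting a late input target past a fresh name and then receiving that name restores the target.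
This lets a close be treated as the communication of a fresh name. -/
theorem Proc.rename_up_succ_inst_zero (P : Proc S) : (P.rename (up Nat.succ) id).inst 0 = P := by
  simp [Proc.inst, Proc.rename_rename, instMap_zero_comp_up_succ, Proc.rename_id]

theorem Proc.inst_shift (P : Proc S) (w : ℕ) :
    (P.inst w).shift = (P.rename (up Nat.succ) id).inst (w + 1) := P.inst_rename w Nat.succ id

/-- The left side is an instantiated target of `Late.resB`: the swap puts the restricted name at `0`
and the received name at `1`. Receiving `w` outside the restriction is thus receiving `w + 1` inside
it. -/
theorem Proc.res_rename_swap01_inst (P : Proc S) (w : ℕ) :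
    (Proc.res (P.rename swap01 id)).inst w = .res (P.inst (w + 1)) := by
  simp [Proc.inst, Proc.rename, Proc.rename_rename, up_instMap_comp_swap01]

theorem Proc.sres_inst (r : Rate) (P : Proc S) (w : ℕ) :
    (Proc.sres r P).inst w = .sres r (P.inst w) := by
  simp [Proc.inst, Proc.rename, up_id]

theorem Proc.inst_sshift (P : Proc S) (w : ℕ) : (P.inst w).sshift = P.sshift.inst w := by
  simp [Proc.inst, Proc.sshift, Proc.rename_rename]

theorem Proc.shift_sshift (P : Proc S) : P.shift.sshift = P.sshift.shift := by
  simp [Proc.shift, Proc.sshift, Proc.rename_rename]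

/-- Structural congruence is preserved by renaming. -/
theorem Cong.rename {D : Env S} {P Q : Proc S} (h : Cong D P Q) :
    ∀ ρ κ : ℕ → ℕ, Cong D (P.rename ρ κ) (Q.rename ρ κ) := by
  induction h with
  | refl P => exact fun _ _ => .refl _
  | symm _ ih => exact fun ρ κ => (ih ρ κ).symm
  | trans _ _ ih₁ ih₂ => exact fun ρ κ => (ih₁ ρ κ).trans (ih₂ ρ κ)
  | parCongr _ _ ih₁ ih₂ => exact fun ρ κ => .parCongr (ih₁ ρ κ) (ih₂ ρ κ)
  | resCongr _ ih => exact fun ρ κ => .resCongr (ih _ κ)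
  | sresCongr r _ ih => exact fun ρ κ => .sresCongr r (ih ρ _)
  | preCongr α _ ih => exact fun ρ κ => .preCongr _ (ih _ κ)
  | plusCongr _ _ ih₁ ih₂ => exact fun ρ κ => .plusCongr (ih₁ ρ κ) (ih₂ ρ κ)
  | resPar P Q =>
    intro ρ κ
    simp only [Proc.rename, Proc.shift_rename]
    exact .resPar _ _
  | sresPar r P Q =>
    intro ρ κ
    simp only [Proc.rename, Proc.sshift_rename]
    exact .sresPar _ _ _
  | resRes P =>
    intro ρ κ
    simp only [Proc.rename, Proc.rename_swap01_rename]
    exact .resRes _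
  | resSres r P => exact fun ρ κ => .resSres _ _
  | sresSres r s P =>
    intro ρ κ
    have : (P.rename id swap01).rename ρ (up (up κ))
        = (P.rename ρ (up (up κ))).rename id swap01 := by
      simp [Proc.rename_rename, swap01_comp_up_up]
    simp only [Proc.rename, this]
    exact .sresSres _ _ _
  | resNil => exact fun ρ κ => .resNil
  | sresNil r => exact fun ρ κ => .sresNil r
  | plusAssoc M₁ M₂ M₃ => exact fun ρ κ => .plusAssoc _ _ _
  | plusComm M N => exact fun ρ κ => .plusComm _ _
  | plusNil M => exact fun ρ κ => .plusNil _
  | parAssoc P₁ P₂ P₃ => exact fun ρ κ => .parAssoc _ _ _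
  | parComm P Q => exact fun ρ κ => .parComm _ _
  | parNil P => exact fun ρ κ => .parNil _
  | call A y =>
    intro ρ κ
    rw [D.substParams_rename]
    exact .call _ _
  | rate r P M =>
    intro ρ κ
    simp only [Proc.rename, Summ.rename, Prefix.rename, Prefix.under, up, Proc.sshift_rename,
      Summ.sshift_rename]
    exact .rate _ _ _

variable {D : Env S}

theorem Cong.parLeft {P P' : Proc S} (h : Cong D P P') (Q : Proc S) :
    Cong D (.par P Q) (.par P' Q) := .parCongr h (.refl Q)

theorem Cong.parRight (P : Proc S) {Q Q' : Proc S} (h : Cong D Q Q') :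
    Cong D (.par P Q) (.par P Q') := .parCongr (.refl P) h

theorem Cong.parRes (P Q : Proc S) : Cong D (.par P (.res Q)) (.res (.par P.shift Q)) :=
  (Cong.parComm _ _).trans ((Cong.resPar _ _).trans (.resCongr (.parComm _ _)))

theorem Cong.parSres (r : Rate) (P Q : Proc S) :
    Cong D (.par P (.sres r Q)) (.sres r (.par P.sshift Q)) :=
  (Cong.parComm _ _).trans ((Cong.sresPar _ _ _).trans (.sresCongr r (.parComm _ _)))

theorem Cong.parRightComm (P Q R : Proc S) :
    Cong D (.par (.par P Q) R) (.par (.par P R) Q) :=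
  (Cong.parAssoc _ _ _).trans ((Cong.parRight P (.parComm _ _)).trans (Cong.parAssoc _ _ _).symm)

/-- Garbage collection of a void binder: insert a parallel `nil`, shrink the scope to it, and remove
the binder there. -/
theorem Cong.sres_sshift (r : Rate) (P : Proc S) : Cong D (.sres r P.sshift) P := by
  have h₁ : Cong D (.par .nil P) P := (Cong.parComm _ _).trans (.parNil P)
  have h₂ : Cong D (.par .nil P.sshift) P.sshift := (Cong.parComm _ _).trans (.parNil _)
  exact (Cong.sresCongr r h₂.symm).trans
    ((Cong.sresPar r .nil P).symm.trans ((Cong.parLeft (.sresNil r) P).trans h₁))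

end Renaming

/-! ## Late transitions of the extended calculus -/

/-- Actions without a bound name: `τ` and free output. -/
inductive FAct : Type
  | tau
  | out (x y : ℕ)

/-- Actions with a bound name, the channel name `0` of the target: bound output and late input. -/
inductive BAct : Type
  | out (x : ℕ)
  | inp (x : ℕ)

/-- Actions of the late transitions. -/
inductive Act : Type
  | free (a : FAct)
  | bound (b : BAct)

def FAct.rename (ρ : ℕ → ℕ) : FAct → FAct
  | tau => tau
  | out x y => out (ρ x) (ρ y)

def BAct.rename (ρ : ℕ → ℕ) : BAct → BAct
  | out x => out (ρ x)
  | inp x => inp (ρ x)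

def Act.rename (ρ : ℕ → ℕ) : Act → Act
  | free a => free (a.rename ρ)
  | bound b => bound (b.rename ρ)

/-- The renaming to be applied to the target of a transition. -/
def Act.under (ρ : ℕ → ℕ) : Act → ℕ → ℕ
  | free _ => ρ
  | bound _ => up ρ

/-- Late transitions on the terms of the extended calculus. -/
inductive Late {S : Sig.{u}} (D : Env S) : Proc S → Act → Proc S → Prop
  | tau (P : Proc S) : Late D (.sum (.pre .tau P)) (.free .tau) P
  | out (x y : ℕ) (P : Proc S) : Late D (.sum (.pre (.out x y) P)) (.free (.out x y)) P
  | inp (x : ℕ) (P : Proc S) : Late D (.sum (.pre (.inp x) P)) (.bound (.inp x)) P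
  | sumL {M : Summ S} {μ : Act} {P' : Proc S} (N : Summ S) :
      Late D (.sum M) μ P' → Late D (.sum (.plus M N)) μ P'
  | sumR {N : Summ S} {μ : Act} {P' : Proc S} (M : Summ S) :
      Late D (.sum N) μ P' → Late D (.sum (.plus M N)) μ P'
  | parL {P P' : Proc S} {a : FAct} (Q : Proc S) :
      Late D P (.free a) P' → Late D (.par P Q) (.free a) (.par P' Q)
  | parR {Q Q' : Proc S} {a : FAct} (P : Proc S) :
      Late D Q (.free a) Q' → Late D (.par P Q) (.free a) (.par P Q')
  | parBL {P P' : Proc S} {b : BAct} (Q : Proc S) :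
      Late D P (.bound b) P' → Late D (.par P Q) (.bound b) (.par P' Q.shift)
  | parBR {Q Q' : Proc S} {b : BAct} (P : Proc S) :
      Late D Q (.bound b) Q' → Late D (.par P Q) (.bound b) (.par P.shift Q')
  | commL {P P' Q Q' : Proc S} {x y : ℕ} :
      Late D P (.free (.out x y)) P' → Late D Q (.bound (.inp x)) Q' →
      Late D (.par P Q) (.free .tau) (.par P' (Q'.inst y))
  | commR {P P' Q Q' : Proc S} {x y : ℕ} :
      Late D P (.bound (.inp x)) P' → Late D Q (.free (.out x y)) Q' →
      Late D (.par P Q) (.free .tau) (.par (P'.inst y) Q')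
  | closeL {P P' Q Q' : Proc S} {x : ℕ} :
      Late D P (.bound (.out x)) P' → Late D Q (.bound (.inp x)) Q' →
      Late D (.par P Q) (.free .tau) (.res (.par P' Q'))
  | closeR {P P' Q Q' : Proc S} {x : ℕ} :
      Late D P (.bound (.inp x)) P' → Late D Q (.bound (.out x)) Q' →
      Late D (.par P Q) (.free .tau) (.res (.par P' Q'))
  | res {P P' : Proc S} {a : FAct} :
      Late D P (.free (a.rename Nat.succ)) P' → Late D (.res P) (.free a) (.res P')
  | resB {P P' : Proc S} {b : BAct} :
      Late D P (.bound (b.rename Nat.succ)) P' →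
      Late D (.res P) (.bound b) (.res (P'.rename swap01 id))
  | opening {P P' : Proc S} {x : ℕ} :
      Late D P (.free (.out (x + 1) 0)) P' → Late D (.res P) (.bound (.out x)) P'
  | sres {P P' : Proc S} {μ : Act} (r : Rate) :
      Late D P μ P' → Late D (.sres r P) μ (.sres r P')
  | call {A : S.Const} {y : Fin (S.arity A) → ℕ} {μ : Act} {P' : Proc S} :
      Late D ((D.body A).substParams y) μ P' → Late D (.call A y) μ P'

-- Late transitions under renaming.

section LateRenaming

variable {S : Sig.{u}} {D : Env S}

theorem FAct.rename_succ_rename (a : FAct) (ρ : ℕ → ℕ) :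
    (a.rename Nat.succ).rename (up ρ) = (a.rename ρ).rename Nat.succ := by
  cases a <;> rfl

theorem BAct.rename_succ_rename (b : BAct) (ρ : ℕ → ℕ) :
    (b.rename Nat.succ).rename (up ρ) = (b.rename ρ).rename Nat.succ := by
  cases b <;> rfl

theorem Act.rename_id (μ : Act) : μ.rename id = μ := by
  rcases μ with (_ | _) | (_ | _) <;> rfl

theorem Act.under_id (μ : Act) : μ.under id = id := by
  cases μ <;> simp [Act.under, up_id]

theorem FAct.rename_succ_injective {a a' : FAct}
    (h : a.rename Nat.succ = a'.rename Nat.succ) : a = a' := by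
  cases a <;> cases a' <;> simp_all [FAct.rename]

theorem BAct.rename_succ_injective {b b' : BAct}
    (h : b.rename Nat.succ = b'.rename Nat.succ) : b = b' := by
  cases b <;> cases b' <;> simp_all [BAct.rename]

theorem up_eq_succ {ρ : ℕ → ℕ} {m n : ℕ} (h : m + 1 = up ρ n) : ∃ k, n = k + 1 ∧ m = ρ k := by
  cases n with
  | zero => simp [up] at h
  | succ k => exact ⟨k, rfl, by simpa [up] using h⟩

theorem up_eq_zero {ρ : ℕ → ℕ} {n : ℕ} (h : 0 = up ρ n) : n = 0 := by
  cases n with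
  | zero => rfl
  | succ k => simp [up] at h

/-- The square formed by `Nat.succ`, `ρ` and `up ρ` is a pullback on names: `up ρ` sends only `0` to
`0`. An action that avoids the restricted name after renaming already avoided it before. -/
theorem FAct.exists_of_rename_succ_eq {a a' : FAct} {ρ : ℕ → ℕ}
    (h : a.rename Nat.succ = a'.rename (up ρ)) :
    ∃ a₀ : FAct, a = a₀.rename ρ ∧ a' = a₀.rename Nat.succ := by
  cases a with
  | tau =>
    cases a' with
    | tau => exact ⟨.tau, rfl, rfl⟩
    | out x y => simp [FAct.rename] at h
  | out x y =>
    cases a' with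
    | tau => simp [FAct.rename] at h
    | out x' y' =>
      simp only [FAct.rename, FAct.out.injEq] at h
      obtain ⟨i, rfl, rfl⟩ := up_eq_succ h.1
      obtain ⟨j, rfl, rfl⟩ := up_eq_succ h.2
      exact ⟨.out i j, rfl, rfl⟩

theorem BAct.exists_of_rename_succ_eq {b b' : BAct} {ρ : ℕ → ℕ}
    (h : b.rename Nat.succ = b'.rename (up ρ)) :
    ∃ b₀ : BAct, b = b₀.rename ρ ∧ b' = b₀.rename Nat.succ := by
  cases b with
  | out x =>
    cases b' with
    | inp x => simp [BAct.rename] at h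
    | out x' =>
      simp only [BAct.rename, BAct.out.injEq] at h
      obtain ⟨i, rfl, rfl⟩ := up_eq_succ h
      exact ⟨.out i, rfl, rfl⟩
  | inp x =>
    cases b' with
    | out x => simp [BAct.rename] at h
    | inp x' =>
      simp only [BAct.rename, BAct.inp.injEq] at h
      obtain ⟨i, rfl, rfl⟩ := up_eq_succ h
      exact ⟨.inp i, rfl, rfl⟩

/-- Late transitions are preserved by renaming. -/
theorem Late.rename {P P' : Proc S} {μ : Act} (h : Late D P μ P') :
    ∀ ρ κ : ℕ → ℕ, Late D (P.rename ρ κ) (μ.rename ρ) (P'.rename (μ.under ρ) κ) := by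
  induction h with
  | tau P => exact fun _ _ => .tau _
  | out x y P => exact fun _ _ => .out _ _ _
  | inp x P => exact fun _ _ => .inp _ _
  | sumL N _ ih => exact fun ρ κ => .sumL _ (ih ρ κ)
  | sumR M _ ih => exact fun ρ κ => .sumR _ (ih ρ κ)
  | parL Q _ ih => exact fun ρ κ => .parL _ (ih ρ κ)
  | parR P _ ih => exact fun ρ κ => .parR _ (ih ρ κ)
  | parBL Q _ ih =>
    intro ρ κ
    simp only [Proc.rename, Act.under, Proc.shift_rename]
    exact .parBL _ (ih ρ κ)
  | parBR P _ ih =>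
    intro ρ κ
    simp only [Proc.rename, Act.under, Proc.shift_rename]
    exact .parBR _ (ih ρ κ)
  | commL _ _ ih₁ ih₂ =>
    intro ρ κ
    simp only [Proc.rename, Act.under, Proc.inst_rename]
    exact .commL (ih₁ ρ κ) (ih₂ ρ κ)
  | commR _ _ ih₁ ih₂ =>
    intro ρ κ
    simp only [Proc.rename, Act.under, Proc.inst_rename]
    exact .commR (ih₁ ρ κ) (ih₂ ρ κ)
  | closeL _ _ ih₁ ih₂ => exact fun ρ κ => .closeL (ih₁ ρ κ) (ih₂ ρ κ)
  | closeR _ _ ih₁ ih₂ => exact fun ρ κ => .closeR (ih₁ ρ κ) (ih₂ ρ κ)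
  | res _ ih =>
    intro ρ κ
    have := ih (up ρ) κ
    simp only [Act.rename, Act.under, FAct.rename_succ_rename] at this
    exact .res this
  | resB _ ih =>
    intro ρ κ
    have := ih (up ρ) κ
    simp only [Act.rename, Act.under, BAct.rename_succ_rename] at this
    simp only [Proc.rename, Act.under, Proc.rename_swap01_rename]
    exact .resB this
  | opening _ ih => exact fun ρ κ => .opening (ih (up ρ) κ)
  | sres r _ ih => exact fun ρ κ => .sres r (ih ρ (up κ))
  | call _ ih =>
    intro ρ κ
    have := ih ρ κ
    rw [D.substParams_rename] at this
    exact .call this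

/-- The late transitions of an injectively renamed term are renamed transitions. -/
theorem Late.of_rename {T R : Proc S} {μ : Act} (h : Late D T μ R) :
    ∀ {P : Proc S} {ρ κ : ℕ → ℕ}, Function.Injective ρ → T = P.rename ρ κ →
      ∃ μ' P', μ = Act.rename ρ μ' ∧ Late D P μ' P' ∧ R = P'.rename (μ'.under ρ) κ := by
  induction h with
  | tau R =>
    rintro (⟨_ | ⟨_ | _ | _ | _ | _, P⟩ | _⟩ | _ | _ | _ | _) ρ κ hρ hT <;>
      simp only [Proc.rename, Summ.rename, Prefix.rename, Proc.sum.injEq, Summ.pre.injEq,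
        reduceCtorEq, false_and] at hT
    exact ⟨_, _, rfl, .tau _, hT.2⟩
  | out x y R =>
    rintro (⟨_ | ⟨_ | _ | _ | _ | _, P⟩ | _⟩ | _ | _ | _ | _) ρ κ hρ hT <;>
      simp only [Proc.rename, Summ.rename, Prefix.rename, Proc.sum.injEq, Summ.pre.injEq,
        reduceCtorEq, false_and, Prefix.out.injEq] at hT
    obtain ⟨⟨rfl, rfl⟩, rfl⟩ := hT
    exact ⟨_, _, rfl, .out _ _ _, rfl⟩
  | inp x R =>
    rintro (⟨_ | ⟨_ | _ | _ | _ | _, P⟩ | _⟩ | _ | _ | _ | _) ρ κ hρ hT <;>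
      simp only [Proc.rename, Summ.rename, Prefix.rename, Proc.sum.injEq, Summ.pre.injEq,
        reduceCtorEq, false_and, Prefix.inp.injEq] at hT
    obtain ⟨rfl, rfl⟩ := hT
    exact ⟨_, _, rfl, .inp _ _, rfl⟩
  | sumL N _ ih =>
    rintro (⟨_ | _ | ⟨M₁, M₂⟩⟩ | _ | _ | _ | _) ρ κ hρ hT <;>
      simp only [Proc.rename, Summ.rename, Proc.sum.injEq, Summ.plus.injEq, reduceCtorEq] at hT
    obtain ⟨rfl, rfl⟩ := hT
    obtain ⟨μ', P', rfl, h, rfl⟩ := ih (P := .sum M₁) hρ rfl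
    exact ⟨_, _, rfl, .sumL _ h, rfl⟩
  | sumR N _ ih =>
    rintro (⟨_ | _ | ⟨M₁, M₂⟩⟩ | _ | _ | _ | _) ρ κ hρ hT <;>
      simp only [Proc.rename, Summ.rename, Proc.sum.injEq, Summ.plus.injEq, reduceCtorEq] at hT
    obtain ⟨rfl, rfl⟩ := hT
    obtain ⟨μ', P', rfl, h, rfl⟩ := ih (P := .sum M₂) hρ rfl
    exact ⟨_, _, rfl, .sumR _ h, rfl⟩
  | parL Q _ ih =>
    rintro (_ | ⟨P₁, P₂⟩ | _ | _ | _) ρ κ hρ hT <;>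
      simp only [Proc.rename, Proc.par.injEq, reduceCtorEq] at hT
    obtain ⟨rfl, rfl⟩ := hT
    obtain ⟨_ | _, P', ⟨⟩, h, rfl⟩ := ih hρ rfl
    exact ⟨_, _, rfl, .parL _ h, rfl⟩
  | parR Q _ ih =>
    rintro (_ | ⟨P₁, P₂⟩ | _ | _ | _) ρ κ hρ hT <;>
      simp only [Proc.rename, Proc.par.injEq, reduceCtorEq] at hT
    obtain ⟨rfl, rfl⟩ := hT
    obtain ⟨_ | _, P', ⟨⟩, h, rfl⟩ := ih hρ rfl
    exact ⟨_, _, rfl, .parR _ h, rfl⟩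
  | parBL Q _ ih =>
    rintro (_ | ⟨P₁, P₂⟩ | _ | _ | _) ρ κ hρ hT <;>
      simp only [Proc.rename, Proc.par.injEq, reduceCtorEq] at hT
    obtain ⟨rfl, rfl⟩ := hT
    obtain ⟨_ | _, P', ⟨⟩, h, rfl⟩ := ih hρ rfl
    exact ⟨_, _, rfl, .parBL _ h, by simp [Proc.rename, Act.under, Proc.shift_rename]⟩
  | parBR Q _ ih =>
    rintro (_ | ⟨P₁, P₂⟩ | _ | _ | _) ρ κ hρ hT <;>
      simp only [Proc.rename, Proc.par.injEq, reduceCtorEq] at hT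
    obtain ⟨rfl, rfl⟩ := hT
    obtain ⟨_ | _, P', ⟨⟩, h, rfl⟩ := ih hρ rfl
    exact ⟨_, _, rfl, .parBR _ h, by simp [Proc.rename, Act.under, Proc.shift_rename]⟩
  | commL _ _ ih₁ ih₂ =>
    rintro (_ | ⟨P₁, P₂⟩ | _ | _ | _) ρ κ hρ hT <;>
      simp only [Proc.rename, Proc.par.injEq, reduceCtorEq] at hT
    obtain ⟨rfl, rfl⟩ := hT
    obtain ⟨(_ | ⟨x, y⟩) | _, P', ⟨⟩, h₁, rfl⟩ := ih₁ hρ rfl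
    obtain ⟨_ | (_ | z), P'', hz, h₂, rfl⟩ := ih₂ hρ rfl <;>
      simp only [Act.rename, BAct.rename, Act.bound.injEq, BAct.inp.injEq, reduceCtorEq] at hz
    -- Injectivity is indispensable here: identifying two channels could enable a communication that
    -- the original term lacks.
    obtain rfl := hρ hz
    exact ⟨.free .tau, _, rfl, .commL h₁ h₂, by simp [Proc.rename, Act.under, Proc.inst_rename]⟩
  | commR _ _ ih₁ ih₂ =>
    rintro (_ | ⟨P₁, P₂⟩ | _ | _ | _) ρ κ hρ hT <;>
      simp only [Proc.rename, Proc.par.injEq, reduceCtorEq] at hT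
    obtain ⟨rfl, rfl⟩ := hT
    obtain ⟨(_ | ⟨x, y⟩) | _, P', ⟨⟩, h₁, rfl⟩ := ih₂ hρ rfl
    obtain ⟨_ | (_ | z), P'', hz, h₂, rfl⟩ := ih₁ hρ rfl <;>
      simp only [Act.rename, BAct.rename, Act.bound.injEq, BAct.inp.injEq, reduceCtorEq] at hz
    obtain rfl := hρ hz
    exact ⟨.free .tau, _, rfl, .commR h₂ h₁, by simp [Proc.rename, Act.under, Proc.inst_rename]⟩
  | closeL _ _ ih₁ ih₂ =>
    rintro (_ | ⟨P₁, P₂⟩ | _ | _ | _) ρ κ hρ hT <;>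
      simp only [Proc.rename, Proc.par.injEq, reduceCtorEq] at hT
    obtain ⟨rfl, rfl⟩ := hT
    obtain ⟨_ | (x | _), P', ⟨⟩, h₁, rfl⟩ := ih₁ hρ rfl
    obtain ⟨_ | (_ | z), P'', hz, h₂, rfl⟩ := ih₂ hρ rfl <;>
      simp only [Act.rename, BAct.rename, Act.bound.injEq, BAct.inp.injEq, reduceCtorEq] at hz
    obtain rfl := hρ hz
    exact ⟨.free .tau, _, rfl, .closeL h₁ h₂, rfl⟩
  | closeR _ _ ih₁ ih₂ =>
    rintro (_ | ⟨P₁, P₂⟩ | _ | _ | _) ρ κ hρ hT <;>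
      simp only [Proc.rename, Proc.par.injEq, reduceCtorEq] at hT
    obtain ⟨rfl, rfl⟩ := hT
    obtain ⟨_ | (x | _), P', ⟨⟩, h₁, rfl⟩ := ih₂ hρ rfl
    obtain ⟨_ | (_ | z), P'', hz, h₂, rfl⟩ := ih₁ hρ rfl <;>
      simp only [Act.rename, BAct.rename, Act.bound.injEq, BAct.inp.injEq, reduceCtorEq] at hz
    obtain rfl := hρ hz
    exact ⟨.free .tau, _, rfl, .closeR h₂ h₁, rfl⟩
  | res _ ih =>
    rintro (_ | _ | P | _ | _) ρ κ hρ hT <;>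
      simp only [Proc.rename, Proc.res.injEq, reduceCtorEq] at hT
    subst hT
    obtain ⟨_ | _, P', hμ, h, rfl⟩ := ih (up_injective hρ) rfl <;>
      simp only [Act.rename, Act.free.injEq, reduceCtorEq] at hμ
    obtain ⟨a₀, rfl, rfl⟩ := FAct.exists_of_rename_succ_eq hμ
    exact ⟨.free a₀, _, rfl, .res h, rfl⟩
  | resB _ ih =>
    rintro (_ | _ | P | _ | _) ρ κ hρ hT <;>
      simp only [Proc.rename, Proc.res.injEq, reduceCtorEq] at hT
    subst hT
    obtain ⟨_ | _, P', hμ, h, rfl⟩ := ih (up_injective hρ) rfl <;>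
      simp only [Act.rename, Act.bound.injEq, reduceCtorEq] at hμ
    obtain ⟨b₀, rfl, rfl⟩ := BAct.exists_of_rename_succ_eq hμ
    exact ⟨.bound b₀, _, rfl, .resB h,
      by simp only [Proc.rename, Act.under, Proc.rename_swap01_rename]⟩
  | opening _ ih =>
    rintro (_ | _ | P | _ | _) ρ κ hρ hT <;>
      simp only [Proc.rename, Proc.res.injEq, reduceCtorEq] at hT
    subst hT
    obtain ⟨(_ | ⟨x, y⟩) | _, P', hμ, h, rfl⟩ := ih (up_injective hρ) rfl <;>
      simp only [Act.rename, FAct.rename, Act.free.injEq, FAct.out.injEq, reduceCtorEq] at hμ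
    obtain ⟨k, rfl, rfl⟩ := up_eq_succ hμ.1
    obtain rfl := up_eq_zero hμ.2
    exact ⟨.bound (.out k), _, rfl, .opening h, rfl⟩
  | sres r _ ih =>
    rintro (_ | _ | _ | ⟨s, P⟩ | _) ρ κ hρ hT <;>
      simp only [Proc.rename, Proc.sres.injEq, reduceCtorEq] at hT
    obtain ⟨rfl, rfl⟩ := hT
    obtain ⟨μ', P', rfl, h, rfl⟩ := ih hρ rfl
    exact ⟨_, _, rfl, .sres r h, rfl⟩
  | call _ ih =>
    rintro (_ | _ | _ | _ | ⟨A, y⟩) ρ κ hρ hT <;>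
      simp only [Proc.rename, Proc.call.injEq, reduceCtorEq] at hT
    obtain ⟨rfl, hy⟩ := hT
    obtain rfl := eq_of_heq hy
    obtain ⟨μ', P', rfl, h, rfl⟩ := ih hρ (D.substParams_rename _ _ ρ κ).symm
    exact ⟨_, _, rfl, .call h, rfl⟩

theorem Late.shift_free {P P' : Proc S} {a : FAct} (h : Late D P (.free a) P') :
    Late D P.shift (.free (a.rename Nat.succ)) P'.shift := h.rename Nat.succ id

theorem Late.shift_bound {P P' : Proc S} {b : BAct} (h : Late D P (.bound b) P') :
    Late D P.shift (.bound (b.rename Nat.succ)) (P'.rename (up Nat.succ) id) :=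
  h.rename Nat.succ id

theorem Late.sshift {P P' : Proc S} {μ : Act} (h : Late D P μ P') :
    Late D P.sshift μ P'.sshift := by
  have := h.rename id Nat.succ
  rwa [Act.rename_id, Act.under_id] at this

theorem Late.of_shift_free {P R : Proc S} {a : FAct} (h : Late D P.shift (.free a) R) :
    ∃ a' P', a = FAct.rename Nat.succ a' ∧ Late D P (.free a') P' ∧ R = P'.shift := by
  obtain ⟨_ | _, P', hμ, h', rfl⟩ := h.of_rename Nat.succ_injective rfl
  · exact ⟨_, _, Act.free.inj hμ, h', rfl⟩
  · cases hμ

theorem Late.of_shift_bound {P R : Proc S} {b : BAct} (h : Late D P.shift (.bound b) R) :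
    ∃ b' P', b = BAct.rename Nat.succ b' ∧ Late D P (.bound b') P' ∧
      R = P'.rename (up Nat.succ) id := by
  obtain ⟨_ | _, P', hμ, h', rfl⟩ := h.of_rename Nat.succ_injective rfl
  · cases hμ
  · exact ⟨_, _, Act.bound.inj hμ, h', rfl⟩

theorem Late.of_sshift {P R : Proc S} {μ : Act} (h : Late D P.sshift μ R) :
    ∃ P', Late D P μ P' ∧ R = P'.sshift := by
  obtain ⟨μ', P', rfl, h, rfl⟩ := h.of_rename Function.injective_id rfl
  exact ⟨P', by rwa [Act.rename_id], by rw [Act.under_id]; rfl⟩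

end LateRenaming

-- Structural congruence is a bisimulation for late transitions.

section Simulation

variable {S : Sig.{u}} {D : Env S}

/-- Every late transition of `P` is matched by `Q`, up to structural congruence. -/
def Simulated (D : Env S) (P Q : Proc S) : Prop :=
  ∀ μ P', Late D P μ P' → ∃ Q', Late D Q μ Q' ∧ Cong D P' Q'

theorem Proc.shift_shift_swap01 (P : Proc S) :
    P.shift.shift.rename swap01 id = P.shift.shift := by
  rw [Proc.shift_rename_swap01, Proc.shift_rename]
  rfl

theorem Cong.shift {P Q : Proc S} (h : Cong D P Q) : Cong D P.shift Q.shift := h.rename _ _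

theorem Cong.inst {P Q : Proc S} (h : Cong D P Q) (w : ℕ) : Cong D (P.inst w) (Q.inst w) :=
  h.rename _ _

theorem Simulated.refl (P : Proc S) : Simulated D P P := fun _ P' h => ⟨P', h, .refl P'⟩

theorem Simulated.trans {P Q R : Proc S} (h₁ : Simulated D P Q) (h₂ : Simulated D Q R) :
    Simulated D P R := by
  intro μ P' h
  obtain ⟨Q', hQ, c₁⟩ := h₁ μ P' h
  obtain ⟨R', hR, c₂⟩ := h₂ μ Q' hQ
  exact ⟨R', hR, c₁.trans c₂⟩

theorem Simulated.par {P P' Q Q' : Proc S} (hP : Simulated D P P') (hQ : Simulated D Q Q')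
    (cP : Cong D P P') (cQ : Cong D Q Q') : Simulated D (.par P Q) (.par P' Q') := by
  intro μ R h
  cases h with
  | parL _ h =>
    obtain ⟨_, h', c⟩ := hP _ _ h
    exact ⟨_, .parL _ h', .parCongr c cQ⟩
  | parR _ h =>
    obtain ⟨_, h', c⟩ := hQ _ _ h
    exact ⟨_, .parR _ h', .parCongr cP c⟩
  | parBL _ h =>
    obtain ⟨_, h', c⟩ := hP _ _ h
    exact ⟨_, .parBL _ h', .parCongr c cQ.shift⟩
  | parBR _ h =>
    obtain ⟨_, h', c⟩ := hQ _ _ h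
    exact ⟨_, .parBR _ h', .parCongr cP.shift c⟩
  | commL h₁ h₂ =>
    obtain ⟨_, h₁', c₁⟩ := hP _ _ h₁
    obtain ⟨_, h₂', c₂⟩ := hQ _ _ h₂
    exact ⟨_, .commL h₁' h₂', .parCongr c₁ (c₂.inst _)⟩
  | commR h₁ h₂ =>
    obtain ⟨_, h₁', c₁⟩ := hP _ _ h₁
    obtain ⟨_, h₂', c₂⟩ := hQ _ _ h₂
    exact ⟨_, .commR h₁' h₂', .parCongr (c₁.inst _) c₂⟩
  | closeL h₁ h₂ =>
    obtain ⟨_, h₁', c₁⟩ := hP _ _ h₁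
    obtain ⟨_, h₂', c₂⟩ := hQ _ _ h₂
    exact ⟨_, .closeL h₁' h₂', .resCongr (.parCongr c₁ c₂)⟩
  | closeR h₁ h₂ =>
    obtain ⟨_, h₁', c₁⟩ := hP _ _ h₁
    obtain ⟨_, h₂', c₂⟩ := hQ _ _ h₂
    exact ⟨_, .closeR h₁' h₂', .resCongr (.parCongr c₁ c₂)⟩

theorem Simulated.res {P P' : Proc S} (hP : Simulated D P P') :
    Simulated D (.res P) (.res P') := by
  intro μ R h
  cases h with
  | res h =>
    obtain ⟨_, h', c⟩ := hP _ _ h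
    exact ⟨_, .res h', .resCongr c⟩
  | resB h =>
    obtain ⟨_, h', c⟩ := hP _ _ h
    exact ⟨_, .resB h', .resCongr (c.rename _ _)⟩
  | opening h =>
    obtain ⟨_, h', c⟩ := hP _ _ h
    exact ⟨_, .opening h', c⟩

theorem Simulated.sres {P P' : Proc S} (r : Rate) (hP : Simulated D P P') :
    Simulated D (.sres r P) (.sres r P') := by
  intro μ R h
  cases h with
  | sres _ h =>
    obtain ⟨_, h', c⟩ := hP _ _ h
    exact ⟨_, .sres r h', .sresCongr r c⟩

theorem Simulated.pre {P P' : Proc S} (α : Prefix) (c : Cong D P P') :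
    Simulated D (.sum (.pre α P)) (.sum (.pre α P')) := by
  intro μ R h
  cases h with
  | tau => exact ⟨_, .tau _, c⟩
  | out => exact ⟨_, .out _ _ _, c⟩
  | inp => exact ⟨_, .inp _ _, c⟩

theorem Simulated.plus {M M' N N' : Summ S} (hM : Simulated D (.sum M) (.sum M'))
    (hN : Simulated D (.sum N) (.sum N')) :
    Simulated D (.sum (.plus M N)) (.sum (.plus M' N')) := by
  intro μ R h
  cases h with
  | sumL _ h =>
    obtain ⟨_, h', c⟩ := hM _ _ h
    exact ⟨_, .sumL _ h', c⟩
  | sumR _ h =>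
    obtain ⟨_, h', c⟩ := hN _ _ h
    exact ⟨_, .sumR _ h', c⟩

theorem Simulated.parComm (P Q : Proc S) : Simulated D (.par P Q) (.par Q P) := by
  intro μ R h
  cases h with
  | parL _ h => exact ⟨_, .parR _ h, .parComm _ _⟩
  | parR _ h => exact ⟨_, .parL _ h, .parComm _ _⟩
  | parBL _ h => exact ⟨_, .parBR _ h, .parComm _ _⟩
  | parBR _ h => exact ⟨_, .parBL _ h, .parComm _ _⟩
  | commL h₁ h₂ => exact ⟨_, .commR h₂ h₁, .parComm _ _⟩
  | commR h₁ h₂ => exact ⟨_, .commL h₂ h₁, .parComm _ _⟩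
  | closeL h₁ h₂ => exact ⟨_, .closeR h₂ h₁, .resCongr (.parComm _ _)⟩
  | closeR h₁ h₂ => exact ⟨_, .closeL h₂ h₁, .resCongr (.parComm _ _)⟩

theorem Proc.par_shift_inst (P Q : Proc S) (w : ℕ) :
    (Proc.par P Q.shift).inst w = .par (P.inst w) Q := by
  have := Q.shift_inst w
  simp_all [Proc.inst, Proc.rename]

theorem Proc.shift_par_inst (P Q : Proc S) (w : ℕ) :
    (Proc.par P.shift Q).inst w = .par P (Q.inst w) := by
  have := P.shift_inst w
  simp_all [Proc.inst, Proc.rename]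

theorem Simulated.parAssoc (P Q R : Proc S) :
    Simulated D (.par (.par P Q) R) (.par P (.par Q R)) := by
  intro μ T h
  cases h with
  | parL _ h =>
    cases h with
    | parL _ h => exact ⟨_, .parL _ h, .parAssoc _ _ _⟩
    | parR _ h => exact ⟨_, .parR _ (.parL _ h), .parAssoc _ _ _⟩
    | commL h₁ h₂ =>
      refine ⟨_, .commL h₁ (.parBL _ h₂), ?_⟩
      rw [Proc.par_shift_inst]
      exact .parAssoc _ _ _
    | commR h₁ h₂ => exact ⟨_, .commR h₁ (.parL _ h₂), .parAssoc _ _ _⟩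
    | closeL h₁ h₂ =>
      -- The close restricts only the inner pair on the left but the whole term on the right; scope
      -- extension reconciles the two.
      exact ⟨_, .closeL h₁ (.parBL _ h₂), (Cong.resPar _ _).trans (.resCongr (.parAssoc _ _ _))⟩
    | closeR h₁ h₂ =>
      exact ⟨_, .closeR h₁ (.parBL _ h₂), (Cong.resPar _ _).trans (.resCongr (.parAssoc _ _ _))⟩
  | parR _ h => exact ⟨_, .parR _ (.parR _ h), .parAssoc _ _ _⟩
  | parBL _ h =>
    cases h with
    | parBL _ h => exact ⟨_, .parBL _ h, .parAssoc _ _ _⟩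
    | parBR _ h => exact ⟨_, .parBR _ (.parBL _ h), .parAssoc _ _ _⟩
  | parBR _ h => exact ⟨_, .parBR _ (.parBR _ h), .parAssoc _ _ _⟩
  | commL h₁ h₂ =>
    cases h₁ with
    | parL _ h =>
      refine ⟨_, .commL h (.parBR _ h₂), ?_⟩
      rw [Proc.shift_par_inst]
      exact .parAssoc _ _ _
    | parR _ h => exact ⟨_, .parR _ (.commL h h₂), .parAssoc _ _ _⟩
  | commR h₁ h₂ =>
    cases h₁ with
    | parBL _ h =>
      refine ⟨_, .commR h (.parR _ h₂), ?_⟩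
      rw [Proc.par_shift_inst]
      exact .parAssoc _ _ _
    | parBR _ h =>
      refine ⟨_, .parR _ (.commR h h₂), ?_⟩
      rw [Proc.shift_par_inst]
      exact .parAssoc _ _ _
  | closeL h₁ h₂ =>
    cases h₁ with
    | parBL _ h => exact ⟨_, .closeL h (.parBR _ h₂), .resCongr (.parAssoc _ _ _)⟩
    | parBR _ h =>
      exact ⟨_, .parR _ (.closeL h h₂),
        (Cong.resCongr (.parAssoc _ _ _)).trans (Cong.parRes _ _).symm⟩
  | closeR h₁ h₂ =>
    cases h₁ with
    | parBL _ h => exact ⟨_, .closeR h (.parBR _ h₂), .resCongr (.parAssoc _ _ _)⟩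
    | parBR _ h =>
      exact ⟨_, .parR _ (.closeR h h₂),
        (Cong.resCongr (.parAssoc _ _ _)).trans (Cong.parRes _ _).symm⟩

/-- Reversing the order of the three factors by commutativity turns this direction into the other
one. -/
theorem Simulated.parAssoc_symm (P Q R : Proc S) :
    Simulated D (.par P (.par Q R)) (.par (.par P Q) R) :=
  (Simulated.par (.refl P) (.parComm Q R) (.refl P) (.parComm Q R)).trans <|
    (Simulated.parComm _ _).trans <| (Simulated.parAssoc R Q P).trans <|
      (Simulated.par (.refl R) (.parComm Q P) (.refl R) (.parComm Q P)).trans <|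
        Simulated.parComm _ _

theorem Late.not_nil {μ : Act} {P' : Proc S} : ¬ Late D .nil μ P' := by
  intro h
  cases h

theorem Simulated.parNil (P : Proc S) : Simulated D (.par P .nil) P := by
  intro μ R h
  cases h with
  | parL _ h => exact ⟨_, h, .parNil _⟩
  | parBL _ h => exact ⟨_, h, .parNil _⟩
  | parR _ h => cases h
  | parBR _ h => cases h
  | commL _ h => cases h
  | commR _ h => cases h
  | closeL _ h => cases h
  | closeR _ h => cases h

theorem Simulated.parNil_symm (P : Proc S) : Simulated D P (.par P .nil) := by
  rintro (_ | _) R h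
  · exact ⟨_, .parL _ h, (Cong.parNil _).symm⟩
  · exact ⟨_, .parBL _ h, (Cong.parNil _).symm⟩

/-- Compares the two targets that arise when a bound action crosses a restriction and its name is
then closed: the two binders come in opposite orders, and only one of them extends over `Q`. -/
theorem Cong.resRes_par (P Q : Proc S) :
    Cong D (.res (.res (.par P (Q.rename (up Nat.succ) id))))
      (.res (.par (.res (P.rename swap01 id)) Q)) := by
  refine (Cong.resRes _).trans (.resCongr ?_)
  simp only [Proc.rename, Proc.rename_up_succ_swap01]
  exact (Cong.resPar _ _).symm

theorem Simulated.resPar (P Q : Proc S) :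
    Simulated D (.par (.res P) Q) (.res (.par P Q.shift)) := by
  intro μ R h
  cases h with
  | parL _ h =>
    cases h with
    | res h => exact ⟨_, .res (.parL _ h), .resPar _ _⟩
  | parR _ h => exact ⟨_, .res (.parR _ h.shift_free), .resPar _ _⟩
  | parBL _ h =>
    cases h with
    | resB h =>
      refine ⟨_, .resB (.parBL _ h), ?_⟩
      simp only [Proc.rename, Proc.shift_shift_swap01]
      exact .resPar _ _
    | opening h => exact ⟨_, .opening (.parL _ h), .refl _⟩
  | parBR _ h =>
    refine ⟨_, .resB (.parBR _ h.shift_bound), ?_⟩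
    simp only [Proc.rename, Proc.rename_up_succ_swap01, Proc.shift_rename_swap01]
    exact .resPar _ _
  | commL h₁ h₂ =>
    cases h₁ with
    | res h =>
      refine ⟨_, .res (.commL h h₂.shift_bound), ?_⟩
      simp only [Nat.succ_eq_add_one, ← Proc.inst_shift]
      exact .resPar _ _
  | commR h₁ h₂ =>
    cases h₁ with
    | resB h =>
      refine ⟨_, .res (.commR h h₂.shift_free), ?_⟩
      rw [Proc.res_rename_swap01_inst]
      exact .resPar _ _
  | closeL h₁ h₂ =>
    cases h₁ with
    | resB h => exact ⟨_, .res (.closeL h h₂.shift_bound), (Cong.resRes_par _ _).symm⟩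
    | opening h =>
      -- Once the binder encloses both partners, extruding its name is an ordinary communication of
      -- the name `0`.
      refine ⟨_, .res (.commL h h₂.shift_bound), ?_⟩
      rw [Proc.rename_up_succ_inst_zero]
      exact .refl _
  | closeR h₁ h₂ =>
    cases h₁ with
    | resB h => exact ⟨_, .res (.closeR h h₂.shift_bound), (Cong.resRes_par _ _).symm⟩

theorem Simulated.resPar_symm (P Q : Proc S) :
    Simulated D (.res (.par P Q.shift)) (.par (.res P) Q) := by
  intro μ R h
  cases h with
  | @res _ _ a h =>
    generalize ha : a.rename Nat.succ = a' at h
    cases h with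
    | parL _ h =>
      subst ha
      exact ⟨_, .parL _ (.res h), (Cong.resPar _ _).symm⟩
    | parR _ h =>
      subst ha
      obtain ⟨a', Q', e, h, rfl⟩ := h.of_shift_free
      obtain rfl := FAct.rename_succ_injective e
      exact ⟨_, .parR _ h, (Cong.resPar _ _).symm⟩
    | @commL _ _ _ _ x y h₁ h₂ =>
      obtain rfl : a = .tau := by cases a <;> simp_all [FAct.rename]
      obtain ⟨_ | x', Q', e, h, rfl⟩ := h₂.of_shift_bound
      · cases e
      obtain rfl : x = x' + 1 := by simpa [BAct.rename] using e
      -- If the transmitted name is the restricted one, narrowing the scope turns the communication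
      -- into a close; otherwise it remains a communication.
      cases y with
      | zero =>
        refine ⟨_, .closeL (.opening h₁) h, ?_⟩
        rw [Proc.rename_up_succ_inst_zero]
        exact .refl _
      | succ y =>
        refine ⟨_, .commL (.res (a := .out x' y) h₁) h, ?_⟩
        rw [← Proc.inst_shift]
        exact (Cong.resPar _ _).symm
    | @commR _ _ _ _ x y h₁ h₂ =>
      obtain rfl : a = .tau := by cases a <;> simp_all [FAct.rename]
      obtain ⟨_ | ⟨x', y'⟩, Q', e, h, rfl⟩ := h₂.of_shift_free
      · cases e
      obtain ⟨rfl, rfl⟩ : x = x' + 1 ∧ y = y' + 1 := by simpa [FAct.rename] using e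
      refine ⟨_, .commR (.resB (b := .inp x') h₁) h, ?_⟩
      rw [Proc.res_rename_swap01_inst]
      exact (Cong.resPar _ _).symm
    | @closeL _ _ _ _ x h₁ h₂ =>
      obtain rfl : a = .tau := by cases a <;> simp_all [FAct.rename]
      obtain ⟨_ | x', Q', e, h, rfl⟩ := h₂.of_shift_bound
      · cases e
      obtain rfl : x = x' + 1 := by simpa [BAct.rename] using e
      exact ⟨_, .closeL (.resB (b := .out x') h₁) h, Cong.resRes_par _ _⟩
    | @closeR _ _ _ _ x h₁ h₂ =>
      obtain rfl : a = .tau := by cases a <;> simp_all [FAct.rename]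
      obtain ⟨x' | _, Q', e, h, rfl⟩ := h₂.of_shift_bound
      · obtain rfl : x = x' + 1 := by simpa [BAct.rename] using e
        exact ⟨_, .closeR (.resB (b := .inp x') h₁) h, Cong.resRes_par _ _⟩
      · cases e
  | resB h =>
    cases h with
    | parBL _ h =>
      refine ⟨_, .parBL _ (.resB h), ?_⟩
      simp only [Proc.rename, Proc.shift_shift_swap01]
      exact (Cong.resPar _ _).symm
    | parBR _ h =>
      obtain ⟨b', Q', e, h, rfl⟩ := h.of_shift_bound
      obtain rfl := BAct.rename_succ_injective e
      refine ⟨_, .parBR _ h, ?_⟩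
      simp only [Proc.rename, Proc.rename_up_succ_swap01, Proc.shift_rename_swap01]
      exact (Cong.resPar _ _).symm
  | opening h =>
    cases h with
    | parL _ h => exact ⟨_, .parBL _ (.opening h), .refl _⟩
    | parR _ h =>
      obtain ⟨_ | ⟨x', y'⟩, Q', e, h, rfl⟩ := h.of_shift_free
      · cases e
      -- The name `0` does not occur in a shifted term, so that component cannot emit it.
      · simp [FAct.rename] at e

theorem Simulated.sresPar (r : Rate) (P Q : Proc S) :
    Simulated D (.par (.sres r P) Q) (.sres r (.par P Q.sshift)) := by
  intro μ R h
  cases h with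
  | parL _ h =>
    cases h with
    | sres _ h => exact ⟨_, .sres r (.parL _ h), .sresPar _ _ _⟩
  | parR _ h => exact ⟨_, .sres r (.parR _ h.sshift), .sresPar _ _ _⟩
  | parBL _ h =>
    cases h with
    | sres _ h =>
      refine ⟨_, .sres r (.parBL _ h), ?_⟩
      rw [← Proc.shift_sshift]
      exact .sresPar _ _ _
  | parBR _ h =>
    refine ⟨_, .sres r (.parBR _ h.sshift), ?_⟩
    simp only [Proc.shift, Proc.rename, up_id]
    exact .sresPar _ _ _
  | commL h₁ h₂ =>
    cases h₁ with
    | sres _ h =>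
      refine ⟨_, .sres r (.commL h h₂.sshift), ?_⟩
      rw [← Proc.inst_sshift]
      exact .sresPar _ _ _
  | commR h₁ h₂ =>
    cases h₁ with
    | sres _ h =>
      refine ⟨_, .sres r (.commR h h₂.sshift), ?_⟩
      rw [Proc.sres_inst]
      exact .sresPar _ _ _
  | closeL h₁ h₂ =>
    cases h₁ with
    | sres _ h =>
      -- The restriction created by the close lies outside the stochastic binder on one side and
      -- inside it on the other.
      exact ⟨_, .sres r (.closeL h h₂.sshift),
        (Cong.resCongr (.sresPar _ _ _)).trans (.resSres _ _)⟩
  | closeR h₁ h₂ =>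
    cases h₁ with
    | sres _ h =>
      exact ⟨_, .sres r (.closeR h h₂.sshift),
        (Cong.resCongr (.sresPar _ _ _)).trans (.resSres _ _)⟩

theorem Simulated.sresPar_symm (r : Rate) (P Q : Proc S) :
    Simulated D (.sres r (.par P Q.sshift)) (.par (.sres r P) Q) := by
  intro μ R h
  cases h with
  | sres _ h =>
    cases h with
    | parL _ h => exact ⟨_, .parL _ (.sres r h), (Cong.sresPar _ _ _).symm⟩
    | parR _ h =>
      obtain ⟨Q', h', rfl⟩ := h.of_sshift
      exact ⟨_, .parR _ h', (Cong.sresPar _ _ _).symm⟩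
    | parBL _ h =>
      refine ⟨_, .parBL _ (.sres r h), ?_⟩
      rw [← Proc.shift_sshift]
      exact (Cong.sresPar _ _ _).symm
    | parBR _ h =>
      obtain ⟨Q', h', rfl⟩ := h.of_sshift
      refine ⟨_, .parBR _ h', ?_⟩
      simp only [Proc.shift, Proc.rename, up_id]
      exact (Cong.sresPar _ _ _).symm
    | commL h₁ h₂ =>
      obtain ⟨Q', h, rfl⟩ := h₂.of_sshift
      refine ⟨_, .commL (.sres r h₁) h, ?_⟩
      rw [← Proc.inst_sshift]
      exact (Cong.sresPar _ _ _).symm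
    | commR h₁ h₂ =>
      obtain ⟨Q', h, rfl⟩ := h₂.of_sshift
      refine ⟨_, .commR (.sres r h₁) h, ?_⟩
      rw [Proc.sres_inst]
      exact (Cong.sresPar _ _ _).symm
    | closeL h₁ h₂ =>
      obtain ⟨Q', h, rfl⟩ := h₂.of_sshift
      exact ⟨_, .closeL (.sres r h₁) h,
        ((Cong.resCongr (.sresPar _ _ _)).trans (.resSres _ _)).symm⟩
    | closeR h₁ h₂ =>
      obtain ⟨Q', h, rfl⟩ := h₂.of_sshift
      exact ⟨_, .closeR (.sres r h₁) h,
        ((Cong.resCongr (.sresPar _ _ _)).trans (.resSres _ _)).symm⟩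

theorem FAct.rename_succ_succ_swap01 (a : FAct) :
    ((a.rename Nat.succ).rename Nat.succ).rename swap01 = (a.rename Nat.succ).rename Nat.succ := by
  cases a <;> rfl

theorem BAct.rename_succ_succ_swap01 (b : BAct) :
    ((b.rename Nat.succ).rename Nat.succ).rename swap01 = (b.rename Nat.succ).rename Nat.succ := by
  cases b <;> rfl

/-- The braid relation for the adjacent transpositions of three names: the bound name of the action
and the two restricted names that it crosses. -/
theorem swap01_braid :
    swap01 ∘ up swap01 ∘ swap01 = up swap01 ∘ swap01 ∘ up swap01 := by
  funext n; rcases n with _ | _ | _ | n <;> rfl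

theorem Simulated.resRes (P : Proc S) :
    Simulated D (.res (.res P)) (.res (.res (P.rename swap01 id))) := by
  intro μ R h
  cases h with
  | res h =>
    cases h with
    | res h =>
      have := h.rename swap01 id
      simp only [Act.rename, Act.under, FAct.rename_succ_succ_swap01] at this
      exact ⟨_, .res (.res this), .resRes _⟩
  | @resB _ _ b h =>
    generalize hb : b.rename Nat.succ = b' at h
    cases h with
    | resB h =>
      subst hb
      have := h.rename swap01 id
      simp only [Act.rename, Act.under, BAct.rename_succ_succ_swap01] at this
      refine ⟨_, .resB (.resB this), ?_⟩
      refine (Cong.resRes _).trans ?_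
      simp only [Proc.rename, Proc.rename_rename, Function.comp_id, swap01_braid]
      exact .refl _
    | opening h =>
      cases b with
      | inp x => cases hb
      | out x =>
        obtain rfl : x + 1 = _ := by simpa [BAct.rename] using hb
        -- After the exchange the opened binder is the outer one, so the output first crosses the
        -- other restriction as a free output.
        exact ⟨_, .opening (.res (a := .out (x + 1) 0) (h.rename swap01 id)), .refl _⟩
  | opening h =>
    generalize ha : FAct.out _ 0 = a at h
    cases h with
    | res h =>
      subst ha
      refine ⟨_, .resB (.opening (h.rename swap01 id)), ?_⟩
      simp only [Act.under, Proc.rename_swap01_swap01]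
      exact .refl _

theorem Simulated.resSres (r : Rate) (P : Proc S) :
    Simulated D (.res (.sres r P)) (.sres r (.res P)) := by
  intro μ R h
  cases h with
  | res h =>
    cases h with
    | sres _ h => exact ⟨_, .sres r (.res h), .resSres _ _⟩
  | resB h =>
    cases h with
    | sres _ h =>
      refine ⟨_, .sres r (.resB h), ?_⟩
      simp only [Proc.rename, up_id]
      exact .resSres _ _
  | opening h =>
    cases h with
    | sres _ h => exact ⟨_, .sres r (.opening h), .refl _⟩

theorem Simulated.resSres_symm (r : Rate) (P : Proc S) :
    Simulated D (.sres r (.res P)) (.res (.sres r P)) := by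
  intro μ R h
  cases h with
  | sres _ h =>
    cases h with
    | res h => exact ⟨_, .res (.sres r h), (Cong.resSres _ _).symm⟩
    | resB h =>
      refine ⟨_, .resB (.sres r h), ?_⟩
      simp only [Proc.rename, up_id]
      exact (Cong.resSres _ _).symm
    | opening h => exact ⟨_, .opening (.sres r h), .refl _⟩

theorem Simulated.sresSres (r s : Rate) (P : Proc S) :
    Simulated D (.sres r (.sres s P)) (.sres s (.sres r (P.rename id swap01))) := by
  intro μ R h
  cases h with
  | sres _ h =>
    cases h with
    | sres _ h =>
      have := h.rename id swap01
      simp only [Act.rename_id, Act.under_id] at this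
      exact ⟨_, .sres s (.sres r this), .sresSres _ _ _⟩

theorem Simulated.plusComm (M N : Summ S) :
    Simulated D (.sum (.plus M N)) (.sum (.plus N M)) := by
  intro μ R h
  cases h with
  | sumL _ h => exact ⟨_, .sumR _ h, .refl _⟩
  | sumR _ h => exact ⟨_, .sumL _ h, .refl _⟩

/-- Delay prefixes have no late transitions, so only `M` can move. The binder left around its target
is void and is garbage-collected. -/
theorem Simulated.rate (r : Rate) (P : Proc S) (M : Summ S) :
    Simulated D (.sum (.plus (.pre (.rate r) P) M))
      (.sres r (.sum (.plus (.pre (.delay 0) P.sshift) M.sshift))) := by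
  intro μ R h
  cases h with
  | sumL _ h => cases h
  | sumR _ h => exact ⟨_, .sres r (.sumR _ h.sshift), (Cong.sres_sshift r _).symm⟩

theorem Simulated.rate_symm (r : Rate) (P : Proc S) (M : Summ S) :
    Simulated D (.sres r (.sum (.plus (.pre (.delay 0) P.sshift) M.sshift)))
      (.sum (.plus (.pre (.rate r) P) M)) := by
  intro μ R h
  cases h with
  | sres _ h =>
    cases h with
    | sumL _ h => cases h
    | sumR _ h =>
      obtain ⟨R', h', rfl⟩ := Late.of_sshift (P := .sum M) h
      exact ⟨_, .sumR _ h', Cong.sres_sshift r _⟩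

/-- Structural congruence is a bisimulation for the late transitions. -/
theorem Cong.simulated {P Q : Proc S} (h : Cong D P Q) : Simulated D P Q ∧ Simulated D Q P := by
  induction h with
  | refl P => exact ⟨.refl P, .refl P⟩
  | symm _ ih => exact ih.symm
  | trans _ _ ih₁ ih₂ => exact ⟨ih₁.1.trans ih₂.1, ih₂.2.trans ih₁.2⟩
  | parCongr h₁ h₂ ih₁ ih₂ => exact ⟨.par ih₁.1 ih₂.1 h₁ h₂, .par ih₁.2 ih₂.2 h₁.symm h₂.symm⟩
  | resCongr _ ih => exact ⟨.res ih.1, .res ih.2⟩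
  | sresCongr r _ ih => exact ⟨.sres r ih.1, .sres r ih.2⟩
  | preCongr α h _ => exact ⟨.pre α h, .pre α h.symm⟩
  | plusCongr _ _ ih₁ ih₂ => exact ⟨.plus ih₁.1 ih₂.1, .plus ih₁.2 ih₂.2⟩
  | resPar P Q => exact ⟨.resPar P Q, .resPar_symm P Q⟩
  | sresPar r P Q => exact ⟨.sresPar r P Q, .sresPar_symm r P Q⟩
  | resRes P =>
    -- The exchange is an involution, so the converse is the same simulation for the exchanged term.
    refine ⟨.resRes P, ?_⟩
    simpa only [Proc.rename_swap01_swap01] using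
      Simulated.resRes (D := D) (P.rename swap01 id)
  | resSres r P => exact ⟨.resSres r P, .resSres_symm r P⟩
  | sresSres r s P =>
    refine ⟨.sresSres r s P, ?_⟩
    simpa only [Proc.rename_rename, Function.comp_id, swap01_comp_swap01, Proc.rename_id] using
      Simulated.sresSres (D := D) s r (P.rename id swap01)
  | resNil =>
    refine ⟨fun μ P' h => ?_, fun μ P' h => (Late.not_nil h).elim⟩
    cases h with
    | res h => exact (Late.not_nil h).elim
    | resB h => exact (Late.not_nil h).elim
    | opening h => exact (Late.not_nil h).elim
  | sresNil r =>
    refine ⟨fun μ P' h => ?_, fun μ P' h => (Late.not_nil h).elim⟩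
    cases h with
    | sres _ h => exact (Late.not_nil h).elim
  | plusAssoc M₁ M₂ M₃ =>
    constructor
    · intro μ R h
      cases h with
      | sumL _ h =>
        cases h with
        | sumL _ h => exact ⟨_, .sumL _ h, .refl _⟩
        | sumR _ h => exact ⟨_, .sumR _ (.sumL _ h), .refl _⟩
      | sumR _ h => exact ⟨_, .sumR _ (.sumR _ h), .refl _⟩
    · intro μ R h
      cases h with
      | sumL _ h => exact ⟨_, .sumL _ (.sumL _ h), .refl _⟩
      | sumR _ h =>
        cases h with
        | sumL _ h => exact ⟨_, .sumL _ (.sumR _ h), .refl _⟩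
        | sumR _ h => exact ⟨_, .sumR _ h, .refl _⟩
  | plusComm M N => exact ⟨.plusComm M N, .plusComm N M⟩
  | plusNil M =>
    refine ⟨fun μ R h => ?_, fun μ R h => ⟨_, .sumL _ h, .refl _⟩⟩
    cases h with
    | sumL _ h => exact ⟨_, h, .refl _⟩
    | sumR _ h => cases h
  | parAssoc P₁ P₂ P₃ => exact ⟨.parAssoc P₁ P₂ P₃, .parAssoc_symm P₁ P₂ P₃⟩
  | parComm P Q => exact ⟨.parComm P Q, .parComm Q P⟩
  | parNil P => exact ⟨.parNil P, .parNil_symm P⟩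
  | call A y =>
    refine ⟨fun μ R h => ?_, fun μ R h => ⟨_, .call h, .refl _⟩⟩
    cases h with
    | call h => exact ⟨_, h, .refl _⟩
  | rate r P M => exact ⟨.rate r P M, .rate_symm r P M⟩

/-- Every reduction is a late silent transition, up to structural congruence. -/
theorem Red.exists_late {l : Option ℕ} {P P' : Proc S} (h : Red D l P P') :
    l = none → ∃ Q, Late D P (.free .tau) Q ∧ Cong D Q P' := by
  induction h with
  | delay => simp
  | tau P M => exact fun _ => ⟨_, .sumL _ (.tau _), .refl _⟩
  | comm x y P Q M N =>
    exact fun _ => ⟨_, .commR (.sumL _ (.inp _ _)) (.sumL _ (.out _ _ _)), .refl _⟩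
  | par Q _ ih =>
    intro hl
    obtain ⟨R, h, c⟩ := ih hl
    exact ⟨_, .parL Q h, c.parLeft Q⟩
  | res _ ih =>
    intro hl
    obtain ⟨R, h, c⟩ := ih hl
    exact ⟨_, .res (a := .tau) h, .resCongr c⟩
  | sres r _ ih =>
    rintro rfl
    obtain ⟨R, h, c⟩ := ih rfl
    exact ⟨_, .sres r h, .sresCongr r c⟩
  | cong h₁ _ h₂ ih =>
    intro hl
    obtain ⟨R, h, c⟩ := ih hl
    obtain ⟨R', h', c'⟩ := h₁.simulated.2 _ _ h
    exact ⟨R', h', c'.symm.trans (c.trans h₂)⟩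

end Simulation

-- Late and early transitions of plain terms.

section EarlyLate

variable {S : Sig.{u}} {D : Env S}

/-- Late inputs of plain terms give early inputs of every name. -/
theorem Late.ltrans_inp {P P' : Proc S} {μ : Act} (h : Late D P μ P') :
    ∀ x, μ = .bound (.inp x) → P.Plain → ∀ w, LTrans D P (.free (.inp x w)) (P'.inst w) := by
  induction h with
  | tau => rintro _ ⟨⟩
  | out => rintro _ ⟨⟩
  | inp x P =>
    rintro _ ⟨⟩ _ w
    exact .inp x w P
  | sumL N _ ih =>
    intro x e hP w
    simp only [Proc.Plain, Summ.Plain] at hP ih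
    exact .sumL _ (ih x e hP.1 w)
  | sumR N _ ih =>
    intro x e hP w
    simp only [Proc.Plain, Summ.Plain] at hP ih
    exact .sumR _ (ih x e hP.2 w)
  | parL => rintro _ ⟨⟩
  | parR => rintro _ ⟨⟩
  | parBL Q _ ih =>
    intro x e hP w
    simp only [Proc.Plain] at hP
    rw [Proc.par_shift_inst]
    exact .parL _ (ih x e hP.1 w)
  | parBR P _ ih =>
    intro x e hP w
    simp only [Proc.Plain] at hP
    rw [Proc.shift_par_inst]
    exact .parR _ (ih x e hP.2 w)
  | commL => rintro _ ⟨⟩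
  | commR => rintro _ ⟨⟩
  | closeL => rintro _ ⟨⟩
  | closeR => rintro _ ⟨⟩
  | res => rintro _ ⟨⟩
  | resB _ ih =>
    rintro x ⟨⟩ hP w
    rw [Proc.res_rename_swap01_inst]
    exact .res (a := .inp x w) (ih (x + 1) rfl hP (w + 1))
  | opening => rintro _ ⟨⟩
  | sres => exact fun _ _ hP => hP.elim
  | call _ ih => exact fun x e _ w => .call (ih x e (D.substParams_plain _ _) w)

/-- The label of the labeled semantics that corresponds to a late action other than an input. -/
def FAct.label : FAct → FLabel
  | tau => .tau
  | out x y => .out x y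

theorem FAct.label_rename_succ (a : FAct) : (a.rename Nat.succ).label = a.label.shift := by
  cases a <;> rfl

/-- Late transitions other than inputs are transitions of the labeled semantics. -/
theorem Late.ltrans {P P' : Proc S} {μ : Act} (h : Late D P μ P') (hP : P.Plain) :
    (∀ a, μ = .free a → LTrans D P (.free a.label) P') ∧
      ∀ x, μ = .bound (.out x) → LTrans D P (.bout x) P' := by
  induction h with
  | tau P => exact ⟨by rintro _ ⟨⟩; exact .tau P, by rintro _ ⟨⟩⟩
  | out x y P => exact ⟨by rintro _ ⟨⟩; exact .out x y P, by rintro _ ⟨⟩⟩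
  | inp x P => exact ⟨by rintro _ ⟨⟩, by rintro _ ⟨⟩⟩
  | sumL N _ ih =>
    simp only [Proc.Plain, Summ.Plain] at hP ih
    exact ⟨fun a e => .sumL _ ((ih hP.1).1 a e), fun x e => .sumL _ ((ih hP.1).2 x e)⟩
  | sumR N _ ih =>
    simp only [Proc.Plain, Summ.Plain] at hP ih
    exact ⟨fun a e => .sumR _ ((ih hP.2).1 a e), fun x e => .sumR _ ((ih hP.2).2 x e)⟩
  | parL Q _ ih => exact ⟨fun a e => .parL _ ((ih hP.1).1 a e), by rintro _ ⟨⟩⟩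
  | parR Q _ ih => exact ⟨fun a e => .parR _ ((ih hP.2).1 a e), by rintro _ ⟨⟩⟩
  | parBL Q _ ih => exact ⟨by rintro _ ⟨⟩, fun a e => .parBoutL _ ((ih hP.1).2 a e)⟩
  | parBR Q _ ih => exact ⟨by rintro _ ⟨⟩, fun a e => .parBoutR _ ((ih hP.2).2 a e)⟩
  | commL _ h₂ ih₁ _ =>
    refine ⟨?_, by rintro _ ⟨⟩⟩
    rintro _ ⟨⟩
    exact .commL ((ih₁ hP.1).1 _ rfl) (h₂.ltrans_inp _ rfl hP.2 _)
  | commR h₁ _ _ ih₂ =>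
    refine ⟨?_, by rintro _ ⟨⟩⟩
    rintro _ ⟨⟩
    exact .commR (h₁.ltrans_inp _ rfl hP.1 _) ((ih₂ hP.2).1 _ rfl)
  | closeL _ h₂ ih₁ _ =>
    refine ⟨?_, by rintro _ ⟨⟩⟩
    rintro _ ⟨⟩
    -- The early close rule asks the shifted partner to input the fresh name `0`; instantiation
    -- there gives back the late target.
    have := h₂.shift_bound.ltrans_inp _ rfl (hP.2.rename _ _) 0
    rw [Proc.rename_up_succ_inst_zero] at this
    exact .closeL ((ih₁ hP.1).2 _ rfl) this
  | closeR h₁ _ _ ih₂ =>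
    refine ⟨?_, by rintro _ ⟨⟩⟩
    rintro _ ⟨⟩
    have := h₁.shift_bound.ltrans_inp _ rfl (hP.1.rename _ _) 0
    rw [Proc.rename_up_succ_inst_zero] at this
    exact .closeR this ((ih₂ hP.2).2 _ rfl)
  | res _ ih =>
    refine ⟨?_, by rintro _ ⟨⟩⟩
    rintro a ⟨⟩
    have := (ih hP).1 _ rfl
    rw [FAct.label_rename_succ] at this
    exact .res this
  | resB _ ih =>
    refine ⟨by rintro _ ⟨⟩, ?_⟩
    rintro x ⟨⟩
    exact .resBout ((ih hP).2 _ rfl)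
  | opening _ ih =>
    refine ⟨by rintro _ ⟨⟩, ?_⟩
    rintro x ⟨⟩
    exact .opening ((ih hP).1 _ rfl)
  | sres => exact hP.elim
  | call _ ih =>
    have := ih (D.substParams_plain _ _)
    exact ⟨fun a e => .call (this.1 a e), fun x e => .call (this.2 x e)⟩

/-- The late counterpart of a transition of the labeled semantics. -/
def LateOf (D : Env S) (P : Proc S) : Label → Proc S → Prop
  | .free .tau, R => Late D P (.free .tau) R
  | .free (.out x y), R => Late D P (.free (.out x y)) R
  | .free (.inp x w), R => ∃ P', Late D P (.bound (.inp x)) P' ∧ R = P'.inst w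
  | .bout x, R => Late D P (.bound (.out x)) R

theorem LateOf.imp {P Q : Proc S} (h : ∀ μ R, Late D P μ R → Late D Q μ R) {l : Label}
    {R : Proc S} (hl : LateOf D P l R) : LateOf D Q l R := by
  rcases l with (_ | _ | _) | _
  · exact h _ _ hl
  · exact h _ _ hl
  · obtain ⟨P', hP', e⟩ := hl
    exact ⟨P', h _ _ hP', e⟩
  · exact h _ _ hl

/-- Early input of a name fresh for the receiver carries the same information as late input, because
the received name can stand for the bound one. -/
theorem late_of_shift_inp {Q R : Proc S} {x : ℕ}
    (h : LateOf D Q.shift (.free (.inp (x + 1) 0)) R) : Late D Q (.bound (.inp x)) R := by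
  obtain ⟨P', h, rfl⟩ := h
  obtain ⟨_ | x', Q', e, h', rfl⟩ := h.of_shift_bound
  · cases e
  obtain rfl : x = x' := by simpa [BAct.rename] using e
  rwa [Proc.rename_up_succ_inst_zero]

/-- The early rules match the late ones once an early input is split into a late input and an
instantiation, which commutes with parallel contexts and restriction. -/
theorem LTrans.lateOf {P R : Proc S} {l : Label} (h : LTrans D P l R) : LateOf D P l R := by
  induction h with
  | tau P => exact .tau P
  | out x y P => exact .out x y P
  | inp x w P => exact ⟨P, .inp x P, rfl⟩
  | sumL N _ ih => exact ih.imp fun _ _ => .sumL N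
  | sumR N _ ih => exact ih.imp fun _ _ => .sumR N
  | @parL _ _ a Q _ ih =>
    rcases a with _ | _ | _
    · exact Late.parL Q ih
    · exact Late.parL Q ih
    · obtain ⟨P', h, rfl⟩ := ih
      exact ⟨_, .parBL Q h, (Proc.par_shift_inst _ _ _).symm⟩
  | @parR _ _ a P _ ih =>
    rcases a with _ | _ | _
    · exact Late.parR P ih
    · exact Late.parR P ih
    · obtain ⟨P', h, rfl⟩ := ih
      exact ⟨_, .parBR P h, (Proc.shift_par_inst _ _ _).symm⟩
  | parBoutL Q _ ih => exact Late.parBL Q ih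
  | parBoutR P _ ih => exact Late.parBR P ih
  | commL _ _ ih₁ ih₂ =>
    obtain ⟨Q', h, rfl⟩ := ih₂
    exact Late.commL ih₁ h
  | commR _ _ ih₁ ih₂ =>
    obtain ⟨Q', h, rfl⟩ := ih₁
    exact Late.commR h ih₂
  | closeL _ _ ih₁ ih₂ => exact Late.closeL ih₁ (late_of_shift_inp ih₂)
  | closeR _ _ ih₁ ih₂ => exact Late.closeR (late_of_shift_inp ih₁) ih₂
  | @res _ _ a _ ih =>
    rcases a with _ | _ | ⟨x, w⟩
    · exact Late.res (a := .tau) ih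
    · exact Late.res (a := .out _ _) ih
    · obtain ⟨P', h, rfl⟩ := ih
      exact ⟨_, .resB (b := .inp x) h, (Proc.res_rename_swap01_inst _ _).symm⟩
  | resBout _ ih => exact Late.resB (b := .out _) ih
  | opening _ ih => exact Late.opening ih
  | call _ ih => exact ih.imp fun _ _ => .call

theorem ltrans_tau_iff_late {P R : Proc S} (hP : P.Plain) :
    LTrans D P (.free .tau) R ↔ Late D P (.free .tau) R :=
  ⟨fun h => h.lateOf, fun h => (h.ltrans hP).1 .tau rfl⟩

end EarlyLate

-- Late silent transitions are reductions.

section LateToRed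

variable {S : Sig.{u}} {D : Env S}

/-- The laws of choice move the acting summand to the front, where the reduction axioms expect it.
-/
theorem Summ.exists_cong_of_late {N : Summ S} {μ : Act} {P' : Proc S}
    (h : Late D (.sum N) μ P') : ∃ α M, Late D (.sum (.pre α P')) μ P' ∧
      Cong D (.sum N) (.sum (.plus (.pre α P') M)) := by
  generalize hT : Proc.sum N = T at h
  induction h generalizing N with
  | tau P => exact ⟨_, .nil, .tau _, (Cong.plusNil _).symm⟩
  | out x y P => exact ⟨_, .nil, .out _ _ _, (Cong.plusNil _).symm⟩
  | inp x P => exact ⟨_, .nil, .inp _ _, (Cong.plusNil _).symm⟩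
  | sumL N' _ ih =>
    obtain ⟨α, M, h, c⟩ := ih rfl
    exact ⟨α, _, h, (Cong.plusCongr c (.refl _)).trans (.plusAssoc _ _ _)⟩
  | sumR N' _ ih =>
    obtain ⟨α, M, h, c⟩ := ih rfl
    exact ⟨α, _, h, (Cong.plusComm _ _).trans
      ((Cong.plusCongr c (.refl _)).trans (.plusAssoc _ _ _))⟩
  | _ => cases hT

theorem Cong.parSwapRight (P Q R : Proc S) : Cong D (.par (.par P Q) R) (.par (.par Q R) P) :=
  (Cong.parAssoc _ _ _).trans (.parComm _ _)

/-- The summation `x(z).T + M`. -/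
def inputSum (x : ℕ) (T : Proc S) (M : Summ S) : Proc S := .sum (.plus (.pre (.inp x) T) M)

theorem inputSum_sshift (x : ℕ) (T : Proc S) (M : Summ S) :
    (inputSum x T M).sshift = inputSum x T.sshift M.sshift := by
  simp [inputSum, Proc.sshift, Summ.sshift, Proc.rename, Summ.rename, Prefix.rename,
    Prefix.under, up_id]

theorem Late.red_out_inputSum_of_sum {N : Summ S} {x y : ℕ} {P' : Proc S}
    (h : Late D (.sum N) (.free (.out x y)) P') (T : Proc S) (M : Summ S) :
    Red D none (.par (.sum N) (inputSum x T M)) (.par P' (T.inst y)) := by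
  obtain ⟨α, N', h, c⟩ := Summ.exists_cong_of_late h
  cases h with
  | out => exact .cong ((c.parLeft _).trans (.parComm _ _)) (.comm x y T P' M N') (.parComm _ _)

/-- An output can be consumed by an input summation in parallel. -/
theorem Late.red_out_inputSum {P P' : Proc S} {μ : Act} (h : Late D P μ P') :
    ∀ x y, μ = .free (.out x y) → ∀ T M,
      Red D none (.par P (inputSum x T M)) (.par P' (T.inst y)) := by
  induction h with
  | tau => rintro _ _ ⟨⟩
  | out x y P =>
    rintro _ _ ⟨⟩
    exact (Late.out x y P).red_out_inputSum_of_sum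
  | inp => rintro _ _ ⟨⟩
  | sumL N h _ =>
    rintro x y rfl
    exact (Late.sumL N h).red_out_inputSum_of_sum
  | sumR N h _ =>
    rintro x y rfl
    exact (Late.sumR N h).red_out_inputSum_of_sum
  | parL Q _ ih =>
    rintro x y e T M
    exact .cong (.parRightComm _ _ _) (.par Q (ih x y (by simpa using e) T M))
      (.parRightComm _ _ _)
  | parR P _ ih =>
    rintro x y e T M
    exact .cong (.parSwapRight _ _ _) (.par P (ih x y (by simpa using e) T M))
      (Cong.parSwapRight _ _ _).symm
  | parBL => rintro _ _ ⟨⟩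
  | parBR => rintro _ _ ⟨⟩
  | commL => rintro _ _ ⟨⟩
  | commR => rintro _ _ ⟨⟩
  | closeL => rintro _ _ ⟨⟩
  | closeR => rintro _ _ ⟨⟩
  | res _ ih =>
    rintro x y ⟨⟩ T M
    refine .cong (.resPar _ _) (.res (ih (x + 1) (y + 1) rfl _ _)) ?_
    simp only [Prefix.under, ← Proc.inst_shift]
    exact (Cong.resPar _ _).symm
  | resB => rintro _ _ ⟨⟩
  | opening => rintro _ _ ⟨⟩
  | sres r _ ih =>
    rintro x y e T M
    refine .cong (.sresPar _ _ _) (.sres r ?_) (Cong.sresPar _ _ _).symm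
    rw [inputSum_sshift, Proc.inst_sshift]
    exact ih x y e _ _
  | call _ ih =>
    intro x y e T M
    exact .cong (.parLeft (.call _ _) _) (ih x y e T M) (.refl _)

/-- A bound output can be consumed by an input summation in parallel. -/
theorem Late.red_bout_inputSum {P P' : Proc S} {μ : Act} (h : Late D P μ P') :
    ∀ x, μ = .bound (.out x) → ∀ T M,
      Red D none (.par P (inputSum x T M)) (.res (.par P' T)) := by
  induction h with
  | tau => rintro _ ⟨⟩
  | out => rintro _ ⟨⟩
  | inp => rintro _ ⟨⟩
  | sumL N h _ =>
    rintro x rfl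
    -- A summation acts through a prefix, and no prefix performs a bound output.
    obtain ⟨_, _, h, _⟩ := Summ.exists_cong_of_late h
    cases h
  | sumR N h _ =>
    rintro x rfl
    obtain ⟨_, _, h, _⟩ := Summ.exists_cong_of_late h
    cases h
  | parL => rintro _ ⟨⟩
  | parR => rintro _ ⟨⟩
  | parBL Q _ ih =>
    rintro x e T M
    exact .cong (.parRightComm _ _ _) (.par Q (ih x (by simpa using e) T M))
      ((Cong.resPar _ _).trans (.resCongr (.parRightComm _ _ _)))
  | parBR P _ ih =>
    rintro x e T M
    exact .cong (.parSwapRight _ _ _) (.par P (ih x (by simpa using e) T M))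
      ((Cong.resPar _ _).trans (.resCongr (Cong.parSwapRight _ _ _).symm))
  | commL => rintro _ ⟨⟩
  | commR => rintro _ ⟨⟩
  | closeL => rintro _ ⟨⟩
  | closeR => rintro _ ⟨⟩
  | res => rintro _ ⟨⟩
  | resB _ ih =>
    rintro x ⟨⟩ T M
    exact .cong (.resPar _ _) (.res (ih (x + 1) rfl _ _)) (.resRes_par _ _)
  | @opening _ _ x h _ =>
    rintro _ ⟨⟩ T M
    -- With the summation inside the scope, the restricted name `0` is sent as a free output;
    -- instantiating the shifted `T` at `0` gives back `T`.
    refine .cong (.resPar _ _) (.res (h.red_out_inputSum (x + 1) 0 rfl _ _)) ?_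
    simp only [Prefix.under, Proc.rename_up_succ_inst_zero]
    exact .refl _
  | sres r _ ih =>
    rintro x e T M
    refine .cong (.sresPar _ _ _) (.sres r ?_)
      ((Cong.resSres _ _).symm.trans (.resCongr (Cong.sresPar _ _ _).symm))
    rw [inputSum_sshift]
    exact ih x e _ _
  | call _ ih =>
    intro x e T M
    exact .cong (.parLeft (.call _ _) _) (ih x e T M) (.refl _)

theorem Late.exists_inputSum {N : Summ S} {x : ℕ} {P' : Proc S}
    (h : Late D (.sum N) (.bound (.inp x)) P') :
    ∃ M, Cong D (.sum N) (inputSum x P' M) := by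
  obtain ⟨α, M, h, c⟩ := Summ.exists_cong_of_late h
  cases h with
  | inp => exact ⟨M, c⟩

/-- The induction follows the derivation of the input and leaves the sender arbitrary, so the sender
can be moved by the scope and parallel laws until it faces the input summation. There
`Late.red_out_inputSum` applies. -/
theorem Late.red_comm {Q Q' : Proc S} {μ : Act} (h : Late D Q μ Q') :
    ∀ x, μ = .bound (.inp x) → ∀ y P P', Late D P (.free (.out x y)) P' →
      Red D none (.par P Q) (.par P' (Q'.inst y)) := by
  have sum : ∀ {N : Summ S} {x y : ℕ} {P P' Q' : Proc S},
      Late D (.sum N) (.bound (.inp x)) Q' → Late D P (.free (.out x y)) P' →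
      Red D none (.par P (.sum N)) (.par P' (Q'.inst y)) := by
    intro N x y P P' Q' hN hP
    obtain ⟨M, c⟩ := hN.exists_inputSum
    exact .cong (c.parRight P) (hP.red_out_inputSum x y rfl _ _) (.refl _)
  induction h with
  | tau => rintro _ ⟨⟩
  | out => rintro _ ⟨⟩
  | inp x P =>
    rintro _ ⟨⟩ y P P' hP
    exact sum (.inp _ _) hP
  | sumL N h _ =>
    rintro x rfl y P P' hP
    exact sum (.sumL N h) hP
  | sumR N h _ =>
    rintro x rfl y P P' hP
    exact sum (.sumR N h) hP
  | parL => rintro _ ⟨⟩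
  | parR => rintro _ ⟨⟩
  | parBL R _ ih =>
    intro x e y P P' hP
    rw [Proc.par_shift_inst]
    exact .cong (Cong.parAssoc _ _ _).symm (.par R (ih x e y P P' hP)) (.parAssoc _ _ _)
  | parBR R _ ih =>
    intro x e y P P' hP
    rw [Proc.shift_par_inst]
    exact .cong ((Cong.parRight _ (.parComm _ _)).trans (Cong.parAssoc _ _ _).symm)
      (.par R (ih x e y P P' hP)) ((Cong.parAssoc _ _ _).trans (.parRight _ (.parComm _ _)))
  | commL => rintro _ ⟨⟩
  | commR => rintro _ ⟨⟩
  | closeL => rintro _ ⟨⟩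
  | closeR => rintro _ ⟨⟩
  | res => rintro _ ⟨⟩
  | resB _ ih =>
    rintro x ⟨⟩ y P P' hP
    rw [Proc.res_rename_swap01_inst]
    exact .cong (.parRes _ _) (.res (ih (x + 1) rfl (y + 1) _ _ hP.shift_free))
      (Cong.parRes _ _).symm
  | opening => rintro _ ⟨⟩
  | sres r _ ih =>
    intro x e y P P' hP
    rw [Proc.sres_inst]
    exact .cong (.parSres _ _ _) (.sres r (ih x e y _ _ hP.sshift)) (Cong.parSres _ _ _).symm
  | call _ ih =>
    intro x e y P P' hP
    exact .cong (.parRight _ (.call _ _)) (ih x e y P P' hP) (.refl _)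

/-- The same induction as for `Late.red_comm`, ending in `Late.red_bout_inputSum`. In addition, the
restriction created by the reduction has to be moved past the surrounding context. -/
theorem Late.red_close {Q Q' : Proc S} {μ : Act} (h : Late D Q μ Q') :
    ∀ x, μ = .bound (.inp x) → ∀ P P', Late D P (.bound (.out x)) P' →
      Red D none (.par P Q) (.res (.par P' Q')) := by
  have sum : ∀ {N : Summ S} {x : ℕ} {P P' Q' : Proc S},
      Late D (.sum N) (.bound (.inp x)) Q' → Late D P (.bound (.out x)) P' →
      Red D none (.par P (.sum N)) (.res (.par P' Q')) := by
    intro N x P P' Q' hN hP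
    obtain ⟨M, c⟩ := hN.exists_inputSum
    exact .cong (c.parRight P) (hP.red_bout_inputSum x rfl _ _) (.refl _)
  induction h with
  | tau => rintro _ ⟨⟩
  | out => rintro _ ⟨⟩
  | inp x P =>
    rintro _ ⟨⟩ P P' hP
    exact sum (.inp _ _) hP
  | sumL N h _ =>
    rintro x rfl P P' hP
    exact sum (.sumL N h) hP
  | sumR N h _ =>
    rintro x rfl P P' hP
    exact sum (.sumR N h) hP
  | parL => rintro _ ⟨⟩
  | parR => rintro _ ⟨⟩
  | parBL R _ ih =>
    intro x e P P' hP
    exact .cong (Cong.parAssoc _ _ _).symm (.par R (ih x e P P' hP))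
      ((Cong.resPar _ _).trans (.resCongr (.parAssoc _ _ _)))
  | parBR R _ ih =>
    intro x e P P' hP
    exact .cong ((Cong.parRight _ (.parComm _ _)).trans (Cong.parAssoc _ _ _).symm)
      (.par R (ih x e P P' hP))
      ((Cong.resPar _ _).trans
        (.resCongr ((Cong.parAssoc _ _ _).trans (.parRight _ (.parComm _ _)))))
  | commL => rintro _ ⟨⟩
  | commR => rintro _ ⟨⟩
  | closeL => rintro _ ⟨⟩
  | closeR => rintro _ ⟨⟩
  | res => rintro _ ⟨⟩
  | resB _ ih =>
    rintro x ⟨⟩ P P' hP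
    exact .cong (.parRes _ _) (.res (ih (x + 1) rfl _ _ hP.shift_bound))
      ((Cong.resCongr (.resCongr (.parComm _ _))).trans
        ((Cong.resRes_par _ _).trans (.resCongr (.parComm _ _))))
  | opening => rintro _ ⟨⟩
  | sres r _ ih =>
    intro x e P P' hP
    exact .cong (.parSres _ _ _) (.sres r (ih x e _ _ hP.sshift))
      ((Cong.resSres _ _).symm.trans (.resCongr (Cong.parSres _ _ _).symm))
  | call _ ih =>
    intro x e P P' hP
    exact .cong (.parRight _ (.call _ _)) (ih x e P P' hP) (.refl _)

/-- Late silent transitions are reductions. -/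
theorem Late.red {P P' : Proc S} {μ : Act} (h : Late D P μ P') :
    μ = .free .tau → Red D none P P' := by
  have sum : ∀ {N : Summ S} {P' : Proc S}, Late D (.sum N) (.free .tau) P' →
      Red D none (.sum N) P' := by
    intro N P' h
    obtain ⟨α, M, h, c⟩ := Summ.exists_cong_of_late h
    cases h with
    | tau => exact .cong c (.tau _ _) (.refl _)
  induction h with
  | tau P => exact fun _ => sum (.tau P)
  | out => rintro ⟨⟩
  | inp => rintro ⟨⟩
  | sumL N h _ =>
    rintro rfl
    exact sum (.sumL N h)
  | sumR N h _ =>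
    rintro rfl
    exact sum (.sumR N h)
  | parL Q _ ih => exact fun e => .par Q (ih e)
  | parR P _ ih => exact fun e => .cong (.parComm _ _) (.par P (ih e)) (.parComm _ _)
  | parBL => rintro ⟨⟩
  | parBR => rintro ⟨⟩
  | commL h₁ h₂ => exact fun _ => h₂.red_comm _ rfl _ _ _ h₁
  | commR h₁ h₂ =>
    exact fun _ => .cong (.parComm _ _) (h₁.red_comm _ rfl _ _ _ h₂) (.parComm _ _)
  | closeL h₁ h₂ => exact fun _ => h₂.red_close _ rfl _ _ h₁
  | closeR h₁ h₂ =>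
    exact fun _ => .cong (.parComm _ _) (h₁.red_close _ rfl _ _ h₂) (.resCongr (.parComm _ _))
  | res _ ih =>
    rintro ⟨⟩
    exact .res (ih rfl)
  | resB => rintro ⟨⟩
  | opening => rintro ⟨⟩
  | sres r _ ih => exact fun e => .sres r (ih e)
  | call _ ih => exact fun e => .cong (.call _ _) (ih e) (.refl _)

/-- Harmony of reductions and silent transitions. -/
theorem red_iff_ltrans_tau {P : Proc S} (hP : P.Plain) (P' : Proc S) :
    Red D none P P' ↔ ∃ Q, LTrans D P (.free .tau) Q ∧ Cong D Q P' := by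
  simp only [ltrans_tau_iff_late hP]
  constructor
  · exact fun h => h.exists_late rfl
  · rintro ⟨Q, h, c⟩
    exact .cong (.refl _) (h.red rfl) c

end LateToRed

-- Induction through unguarded constants.

section Induction

variable {S : Sig.{u}}

theorem Proc.induction_of_heads {motive : Proc S → Prop} (sum : ∀ M, motive (.sum M))
    (par : ∀ P Q, motive P → motive Q → motive (.par P Q))
    (res : ∀ P, motive P → motive (.res P)) (sres : ∀ r P, motive P → motive (.sres r P)) :
    ∀ P : Proc S, (∀ A ∈ P.heads, ∀ y, motive (.call A y)) → motive P
  | .sum M, _ => sum M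
  | .par P Q, h =>
    par P Q (Proc.induction_of_heads sum par res sres P fun A hA => h A (.inl hA))
      (Proc.induction_of_heads sum par res sres Q fun A hA => h A (.inr hA))
  | .res P, h => res P (Proc.induction_of_heads sum par res sres P h)
  | .sres r P, h => sres r P (Proc.induction_of_heads sum par res sres P h)
  | .call A y, h => h A rfl y

/-- Induction on the unguarded structure of a term, where constants are replaced by their
instantiated defining terms. -/
theorem Env.proc_induction (D : Env S) {motive : Proc S → Prop} (sum : ∀ M, motive (.sum M))
    (par : ∀ P Q, motive P → motive Q → motive (.par P Q))
    (res : ∀ P, motive P → motive (.res P)) (sres : ∀ r P, motive P → motive (.sres r P))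
    (call : ∀ A y, motive ((D.body A).substParams y) → motive (.call A y)) (P : Proc S) :
    motive P := by
  suffices h : ∀ A y, motive (.call A y) from
    Proc.induction_of_heads sum par res sres P fun A _ => h A
  intro A
  induction A using D.wf.induction with
  | _ A ih =>
    intro y
    -- The constants unguarded in the instantiated body are those of the body itself, and they
    -- precede `A` in the well-founded order.
    refine call A y (Proc.induction_of_heads sum par res sres _ fun B hB => ih B ?_)
    rwa [Proc.substParams, Proc.heads_rename] at hB

end Induction

-- Term operations on congruence classes.

section Classes

variable {S : Sig.{u}} {D : Env S}

theorem cls_eq_iff {P Q : Proc S} : cls D P = cls D Q ↔ Cong D P Q :=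
  ⟨fun h => Quotient.exact h, fun h => Quotient.sound h⟩

theorem Cong.cls_eq {P Q : Proc S} (h : Cong D P Q) : cls D P = cls D Q := cls_eq_iff.2 h

theorem CongClass.exists_rep (e : CongClass D) : ∃ P, cls D P = e := Quotient.exists_rep e

/-- Parallel composition of congruence classes. -/
def parClass : CongClass D → CongClass D → CongClass D :=
  Quotient.map₂ Proc.par fun _ _ h₁ _ _ h₂ => Cong.parCongr h₁ h₂

/-- Restriction of congruence classes. -/
def resClass : CongClass D → CongClass D :=
  Quotient.map Proc.res fun _ _ h => Cong.resCongr h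

/-- Renaming of congruence classes. -/
def renameClass (ρ κ : ℕ → ℕ) : CongClass D → CongClass D :=
  Quotient.map (Proc.rename ρ κ) fun _ _ h => Cong.rename h ρ κ

@[simp] theorem parClass_cls (P Q : Proc S) : parClass (cls D P) (cls D Q) = cls D (.par P Q) :=
  rfl

@[simp] theorem resClass_cls (P : Proc S) : resClass (cls D P) = cls D (.res P) := rfl

@[simp] theorem sresClass_cls (r : Rate) (P : Proc S) :
    sresClass D r (cls D P) = cls D (.sres r P) := rfl

@[simp] theorem renameClass_cls (ρ κ : ℕ → ℕ) (P : Proc S) :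
    renameClass ρ κ (cls D P) = cls D (P.rename ρ κ) := rfl

end Classes

-- The multiset of unguarded delays as a congruence invariant.

section Delays

variable {S : Sig.{u}}

/-- The kind of an unguarded delay: a rate, or a free stochastic name. -/
abbrev DelayKind : Type := Rate ⊕ ℕ

/-- The effect of a stochastic binder on the kind of a delay in its scope. -/
def DelayKind.bind (r : Rate) : DelayKind → DelayKind
  | .inl s => .inl s
  | .inr 0 => .inl r
  | .inr (q + 1) => .inr q

/-- The delays of a summation, with the congruence classes of their targets. -/
def Summ.delays (D : Env S) : Summ S → Multiset (DelayKind × CongClass D)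
  | .nil => 0
  | .pre (.rate r) P => {(.inl r, cls D P)}
  | .pre (.delay q) P => {(.inr q, cls D P)}
  | .pre _ _ => 0
  | .plus M N => M.delays D + N.delays D

/-- An assignment of delays to the instances of the constants. -/
abbrev DelayEnv (D : Env S) : Type u :=
  ∀ A : S.Const, (Fin (S.arity A) → ℕ) → Multiset (DelayKind × CongClass D)

/-- The unguarded delays of a term, with the congruence classes of their targets, if `v` gives
these for the constants. -/
def Proc.delays {D : Env S} (v : DelayEnv D) : Proc S → Multiset (DelayKind × CongClass D)
  | .sum M => M.delays D
  | .par P Q => (P.delays v).map (Prod.map id fun e => parClass e (cls D Q)) +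
      (Q.delays v).map (Prod.map id fun e => parClass (cls D P) e)
  | .res P => (P.delays v).map (Prod.map id resClass)
  | .sres r P => (P.delays v).map (Prod.map (DelayKind.bind r) (sresClass D r))
  | .call A y => v A y

theorem Proc.delays_congr {D : Env S} {v w : DelayEnv D} : ∀ P : Proc S,
    (∀ A ∈ P.heads, v A = w A) → P.delays v = P.delays w
  | .sum M, _ => rfl
  | .par P Q, h => by
    simp only [Proc.delays, Proc.delays_congr P fun A hA => h A (.inl hA),
      Proc.delays_congr Q fun A hA => h A (.inr hA)]
  | .res P, h => by simp only [Proc.delays, Proc.delays_congr P h]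
  | .sres r P, h => by simp only [Proc.delays, Proc.delays_congr P h]
  | .call A y, h => by simp only [Proc.delays, h A rfl]

/-- The assignment `v` agrees with the defining equations. -/
def DelayEnv.Coherent {D : Env S} (v : DelayEnv D) : Prop :=
  ∀ A y, v A y = ((D.body A).substParams y).delays v

open Classical in
theorem Env.exists_delayEnv (D : Env S) : ∃ v : DelayEnv D, v.Coherent := by
  let F : ∀ A : S.Const, (∀ B, B ∈ (D.body A).heads → (Fin (S.arity B) → ℕ) →
      Multiset (DelayKind × CongClass D)) → (Fin (S.arity A) → ℕ) →
      Multiset (DelayKind × CongClass D) := fun A ih y =>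
    ((D.body A).substParams y).delays
      -- The default `0` is never consulted: the delays of the body depend only on the constants
      -- that are unguarded in it.
      fun B z => if h : B ∈ (D.body A).heads then ih B h z else 0
  refine ⟨D.wf.fix F, fun A y => ?_⟩
  rw [WellFounded.fix_eq]
  refine Proc.delays_congr _ fun B hB => ?_
  rw [Proc.substParams, Proc.heads_rename] at hB
  simp [hB]

variable {D : Env S} {v : DelayEnv D}

theorem Summ.delays_rename (ρ κ : ℕ → ℕ) : ∀ M : Summ S, (M.rename ρ κ).delays D
    = (M.delays D).map (Prod.map (Sum.map id κ) (renameClass ρ κ))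
  | .nil => rfl
  | .pre α P => by
    cases α <;> simp [Summ.rename, Prefix.rename, Summ.delays, Prefix.under]
  | .plus M N => by
    simp [Summ.rename, Summ.delays, Summ.delays_rename ρ κ M, Summ.delays_rename ρ κ N]

/-- Needed for the scope laws, which shift or permute names. Coherence relates the values of `v` at
renamed arguments, by unfolding the constant. -/
theorem Proc.delays_rename (hv : v.Coherent) (P : Proc S) : ∀ ρ κ : ℕ → ℕ,
    (P.rename ρ κ).delays v
      = (P.delays v).map (Prod.map (Sum.map id κ) (renameClass ρ κ)) := by
  induction P using D.proc_induction with
  | sum M => exact fun ρ κ => Summ.delays_rename ρ κ M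
  | par P Q ihP ihQ =>
    intro ρ κ
    simp only [Proc.rename, Proc.delays, ihP, ihQ, Multiset.map_add, Multiset.map_map]
    congr 1 <;>
    · refine Multiset.map_congr rfl ?_
      rintro ⟨k, e⟩ _
      obtain ⟨R, rfl⟩ := e.exists_rep
      simp [Proc.rename]
  | res P ih =>
    intro ρ κ
    simp only [Proc.rename, Proc.delays, ih, Multiset.map_map]
    refine Multiset.map_congr rfl ?_
    rintro ⟨k, e⟩ _
    obtain ⟨R, rfl⟩ := e.exists_rep
    simp [Proc.rename]
  | sres r P ih =>
    intro ρ κ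
    simp only [Proc.rename, Proc.delays, ih, Multiset.map_map]
    refine Multiset.map_congr rfl ?_
    rintro ⟨k, e⟩ _
    obtain ⟨R, rfl⟩ := e.exists_rep
    rcases k with _ | _ | q <;> simp [Proc.rename, DelayKind.bind, up]
  | call A y ih =>
    intro ρ κ
    simp only [Proc.rename, Proc.delays]
    rw [hv, hv, ← ih, D.substParams_rename]

/-- Each law matches unguarded delays one to one and, applied once more to the targets, makes these
congruent. Recording classes instead of terms therefore yields equality. -/
theorem Cong.delays_eq (hv : v.Coherent) {P Q : Proc S} (h : Cong D P Q) :
    P.delays v = Q.delays v := by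
  induction h with
  | refl P => rfl
  | symm _ ih => exact ih.symm
  | trans _ _ ih₁ ih₂ => exact ih₁.trans ih₂
  | parCongr h₁ h₂ ih₁ ih₂ => simp only [Proc.delays, ih₁, ih₂, h₁.cls_eq, h₂.cls_eq]
  | resCongr _ ih => simp only [Proc.delays, ih]
  | sresCongr r _ ih => simp only [Proc.delays, ih]
  | preCongr α h _ => cases α <;> simp [Proc.delays, Summ.delays, h.cls_eq]
  | plusCongr _ _ ih₁ ih₂ =>
    simp only [Proc.delays] at ih₁ ih₂
    simp only [Proc.delays, Summ.delays, ih₁, ih₂]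
  | resPar P Q =>
    simp only [Proc.delays, Proc.shift, Proc.delays_rename hv, Multiset.map_add,
      Multiset.map_map]
    congr 1 <;>
    · refine Multiset.map_congr rfl ?_
      rintro ⟨k, e⟩ _
      obtain ⟨R, rfl⟩ := e.exists_rep
      simpa [Proc.shift] using (Cong.resPar _ _).cls_eq
  | sresPar r P Q =>
    simp only [Proc.delays, Proc.sshift, Proc.delays_rename hv, Multiset.map_add,
      Multiset.map_map]
    congr 1 <;>
    · refine Multiset.map_congr rfl ?_
      rintro ⟨k, e⟩ _
      obtain ⟨R, rfl⟩ := e.exists_rep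
      rcases k with _ | _ | q <;>
        simpa [DelayKind.bind, Proc.sshift] using (Cong.sresPar _ _ _).cls_eq
  | resRes P =>
    simp only [Proc.delays, Proc.delays_rename hv, Multiset.map_map]
    refine Multiset.map_congr rfl ?_
    rintro ⟨k, e⟩ _
    obtain ⟨R, rfl⟩ := e.exists_rep
    simpa using (Cong.resRes _).cls_eq
  | resSres r P =>
    simp only [Proc.delays, Multiset.map_map]
    refine Multiset.map_congr rfl ?_
    rintro ⟨k, e⟩ _
    obtain ⟨R, rfl⟩ := e.exists_rep
    simpa using (Cong.resSres _ _).cls_eq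
  | sresSres r s P =>
    simp only [Proc.delays, Proc.delays_rename hv, Multiset.map_map]
    refine Multiset.map_congr rfl ?_
    rintro ⟨k, e⟩ _
    obtain ⟨R, rfl⟩ := e.exists_rep
    rcases k with _ | _ | _ | q <;>
      simpa [DelayKind.bind, swap01] using (Cong.sresSres _ _ _).cls_eq
  | resNil => rfl
  | sresNil r => rfl
  | plusAssoc M₁ M₂ M₃ => simp only [Proc.delays, Summ.delays, add_assoc]
  | plusComm M N => simp only [Proc.delays, Summ.delays, add_comm]
  | plusNil M => simp only [Proc.delays, Summ.delays, add_zero]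
  | parAssoc P₁ P₂ P₃ =>
    simp only [Proc.delays, Multiset.map_add, Multiset.map_map, add_assoc]
    congr 1
    · refine Multiset.map_congr rfl ?_
      rintro ⟨k, e⟩ _
      obtain ⟨R, rfl⟩ := e.exists_rep
      simpa using (Cong.parAssoc _ _ _).cls_eq
    · congr 1 <;>
      · refine Multiset.map_congr rfl ?_
        rintro ⟨k, e⟩ _
        obtain ⟨R, rfl⟩ := e.exists_rep
        simpa using (Cong.parAssoc _ _ _).cls_eq
  | parComm P Q =>
    simp only [Proc.delays]
    rw [add_comm]
    congr 1 <;>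
    · refine Multiset.map_congr rfl ?_
      rintro ⟨k, e⟩ _
      obtain ⟨R, rfl⟩ := e.exists_rep
      simpa using (Cong.parComm _ _).cls_eq
  | parNil P =>
    simp only [Proc.delays, Proc.nil, Summ.delays, Multiset.map_zero, add_zero]
    refine (Multiset.map_congr rfl ?_).trans (Multiset.map_id _)
    rintro ⟨k, e⟩ _
    obtain ⟨R, rfl⟩ := e.exists_rep
    simpa [Proc.nil] using (Cong.parNil _).cls_eq
  | call A y => exact hv A y
  | rate r P M =>
    simp only [Proc.delays, Summ.delays, Summ.sshift, Summ.delays_rename, Multiset.map_add,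
      Multiset.map_map, Multiset.map_singleton]
    congr 1
    -- The binder turns the name `0` into the rate `r`, and it is void in the target.
    · simpa [DelayKind.bind] using (Cong.sres_sshift r P).symm.cls_eq
    -- For the delays of `M` the binder undoes the shift of the names and is again void in the
    -- targets.
    · refine ((Multiset.map_congr rfl ?_).trans (Multiset.map_id _)).symm
      rintro ⟨k, e⟩ _
      obtain ⟨R, rfl⟩ := e.exists_rep
      rcases k with _ | q <;>
        simpa [DelayKind.bind, Proc.sshift] using (Cong.sres_sshift r R).cls_eq

/-- The symbolic delay transitions of a term are among its delays. -/
theorem Red.mem_delays (hv : v.Coherent) {l : Option ℕ} {P P' : Proc S} (h : Red D l P P') :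
    ∀ q, l = some q → (Sum.inr q, cls D P') ∈ P.delays v := by
  induction h with
  | delay q P M =>
    rintro _ ⟨⟩
    simp [Proc.delays, Summ.delays]
  | tau => simp
  | comm => simp
  | par Q _ ih =>
    intro q e
    exact Multiset.mem_add.2 (.inl (Multiset.mem_map_of_mem (Prod.map id _) (ih q e)))
  | res _ ih =>
    intro q e
    exact Multiset.mem_map_of_mem (Prod.map id _) (ih q e)
  | sres r _ ih =>
    rintro q rfl
    exact Multiset.mem_map_of_mem (Prod.map (DelayKind.bind r) _) (ih (q + 1) rfl)
  | cong h₁ _ h₂ ih =>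
    intro q e
    rw [h₁.delays_eq hv, ← h₂.cls_eq]
    exact ih q e

end Delays

-- Delays of plain terms enumerate Markovian transitions.

section Enumeration

variable {S : Sig.{u}} {D : Env S} {v : DelayEnv D}

/-- The kind of delay and the congruence class of the target of a Markovian transition. -/
def delayOf (D : Env S) (t : Rate × List Pos × Proc S) : DelayKind × CongClass D :=
  (.inl t.1, cls D t.2.2)

/-- The multiset `m` lists the Markovian transitions of `P`, each of them once. -/
def Enumerates (D : Env S) (P : Proc S) (m : Multiset (Rate × List Pos × Proc S)) : Prop :=
  m.Nodup ∧ ∀ t, t ∈ m ↔ MTrans D P t.1 t.2.1 t.2.2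

/-- The transitions obtained by a map of the targets and a symbol in front of the identifiers. -/
def extend (c : Pos) (g : Proc S → Proc S) (t : Rate × List Pos × Proc S) :
    Rate × List Pos × Proc S := (t.1, c :: t.2.1, g t.2.2)

theorem extend_injective (c : Pos) {g : Proc S → Proc S} (hg : Function.Injective g) :
    Function.Injective (extend c g) := by
  rintro ⟨r, i, P⟩ ⟨r', i', P'⟩ h
  simp only [extend, Prod.mk.injEq, List.cons.injEq, true_and] at h
  rw [h.1, h.2.1, hg h.2.2]

/-- The first letter of the identifier separates the two sides, even if rates and targets agree.
This is how multiplicities survive in a set of transitions. -/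
theorem nodup_extend_add {m n : Multiset (Rate × List Pos × Proc S)} (hm : m.Nodup)
    (hn : n.Nodup) {c d : Pos} (hcd : c ≠ d) {g g' : Proc S → Proc S}
    (hg : Function.Injective g) (hg' : Function.Injective g') :
    (m.map (extend c g) + n.map (extend d g')).Nodup := by
  refine Multiset.nodup_add.2
    ⟨hm.map (extend_injective c hg), hn.map (extend_injective d hg'), ?_⟩
  rw [Multiset.disjoint_left]
  intro t h₁ h₂
  obtain ⟨t₁, _, rfl⟩ := Multiset.mem_map.1 h₁
  obtain ⟨t₂, _, h⟩ := Multiset.mem_map.1 h₂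
  simp only [extend, Prod.mk.injEq, List.cons.injEq] at h
  exact hcd h.2.1.1.symm

theorem Summ.exists_enumerates : ∀ M : Summ S, M.Plain →
    ∃ m, Enumerates D (.sum M) m ∧ m.map (delayOf D) = M.delays D
  | .nil, _ => by
    refine ⟨0, ⟨Multiset.nodup_zero, fun t => ⟨fun h => by simp at h, fun h => ?_⟩⟩, rfl⟩
    cases h
  | .pre α P, h => by
    by_cases hα : ∃ r, α = .rate r
    · obtain ⟨r, rfl⟩ := hα
      refine ⟨{(r, [], P)}, ⟨Multiset.nodup_singleton _, ?_⟩, rfl⟩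
      rintro ⟨r', i, P'⟩
      rw [Multiset.mem_singleton]
      constructor
      · rintro ⟨⟩
        exact .rate r P
      · intro h
        generalize hT : Proc.sum (Summ.pre (Prefix.rate r) P) = T at h
        cases h <;> cases hT
        rfl
    · refine ⟨0, ⟨Multiset.nodup_zero, ?_⟩, ?_⟩
      · rintro ⟨r, i, P'⟩
        refine ⟨fun h => by simp at h, fun h => ?_⟩
        generalize hT : Proc.sum (Summ.pre α P) = T at h
        cases h <;> cases hT
        exact (hα ⟨_, rfl⟩).elim
      · cases α <;> simp_all [Summ.delays, Summ.Plain, Prefix.Plain]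
  | .plus M N, h => by
    simp only [Summ.Plain] at h
    obtain ⟨m, ⟨hm, hm'⟩, em⟩ := Summ.exists_enumerates M h.1
    obtain ⟨n, ⟨hn, hn'⟩, en⟩ := Summ.exists_enumerates N h.2
    refine ⟨m.map (extend .sum0 id) + n.map (extend .sum1 id),
      ⟨nodup_extend_add hm hn (by simp) Function.injective_id Function.injective_id, ?_⟩, ?_⟩
    · rintro ⟨r, i, P'⟩
      simp only [Multiset.mem_add, Multiset.mem_map, hm', hn']
      constructor
      · rintro (⟨t, h, ⟨⟩⟩ | ⟨t, h, ⟨⟩⟩)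
        · exact .sumL N h
        · exact .sumR M h
      · intro h
        cases h with
        | @sumL _ _ i _ _ h => exact .inl ⟨(r, i, P'), h, rfl⟩
        | @sumR _ _ i _ _ h => exact .inr ⟨(r, i, P'), h, rfl⟩
    · simp only [Multiset.map_add, Multiset.map_map, Summ.delays, ← em, ← en]
      rfl

/-- The rules for Markovian transitions and the equations for delays recurse in the same way. The
induction unfolds constants, which alters neither identifiers nor targets. -/
theorem Proc.exists_enumerates (hv : v.Coherent) (P : Proc S) : P.Plain →
    ∃ m, Enumerates D P m ∧ m.map (delayOf D) = P.delays v := by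
  induction P using D.proc_induction with
  | sum M => exact Summ.exists_enumerates M
  | par P Q ihP ihQ =>
    intro h
    obtain ⟨m, ⟨hm, hm'⟩, em⟩ := ihP h.1
    obtain ⟨n, ⟨hn, hn'⟩, en⟩ := ihQ h.2
    refine ⟨m.map (extend .par0 fun R => .par R Q) + n.map (extend .par1 fun R => .par P R),
      ⟨nodup_extend_add hm hn (by simp) (fun _ _ h => by simpa using h)
        (fun _ _ h => by simpa using h), ?_⟩, ?_⟩
    · rintro ⟨r, i, P'⟩
      simp only [Multiset.mem_add, Multiset.mem_map, hm', hn']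
      constructor
      · rintro (⟨t, h, ⟨⟩⟩ | ⟨t, h, ⟨⟩⟩)
        · exact .parL Q h
        · exact .parR P h
      · intro h
        cases h with
        | @parL _ P' _ i _ h => exact .inl ⟨(r, i, P'), h, rfl⟩
        | @parR _ P' _ i _ h => exact .inr ⟨(r, i, P'), h, rfl⟩
    · simp only [Multiset.map_add, Multiset.map_map, Proc.delays, ← em, ← en]
      rfl
  | res P ih =>
    intro h
    obtain ⟨m, ⟨hm, hm'⟩, em⟩ := ih h
    refine ⟨m.map fun t => (t.1, t.2.1, .res t.2.2), ⟨hm.map ?_, ?_⟩, ?_⟩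
    · rintro ⟨r, i, P⟩ ⟨r', i', P'⟩ h
      simpa using h
    · rintro ⟨r, i, P'⟩
      simp only [Multiset.mem_map, hm']
      constructor
      · rintro ⟨t, h, ⟨⟩⟩
        exact .res h
      · intro h
        cases h with
        | @res _ P' _ i h => exact ⟨(r, i, P'), h, rfl⟩
    · simp only [Multiset.map_map, Proc.delays, ← em]
      rfl
  | sres r P _ => exact fun h => h.elim
  | call A y ih =>
    intro _
    obtain ⟨m, ⟨hm, hm'⟩, em⟩ := ih (D.substParams_plain A y)
    refine ⟨m, ⟨hm, fun t => (hm' t).trans ⟨.call, fun h => ?_⟩⟩, em.trans (hv A y).symm⟩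
    cases h with
    | call h => exact h

/-- Every delay of a plain term comes from a Markovian transition, which carries a rate. -/
theorem Proc.not_inr_mem_delays_of_plain (hv : v.Coherent) {P : Proc S} (hP : P.Plain) (q : ℕ)
    (e : CongClass D) : (Sum.inr q, e) ∉ P.delays v := by
  obtain ⟨m, _, hm⟩ := Proc.exists_enumerates hv P hP
  rw [← hm]
  simp [delayOf]

theorem DelayEnv.Coherent.not_inr_mem (hv : v.Coherent) (A : S.Const)
    (y : Fin (S.arity A) → ℕ) (q : ℕ) (e : CongClass D) : (Sum.inr q, e) ∉ v A y := by
  rw [hv]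
  exact Proc.not_inr_mem_delays_of_plain hv (D.substParams_plain A y) q e

end Enumeration

-- From delays to symbolic transitions and active binders.

section Active

variable {S : Sig.{u}} {D : Env S} {v : DelayEnv D}

theorem Red.rename {l : Option ℕ} {P P' : Proc S} (h : Red D l P P') :
    ∀ ρ κ : ℕ → ℕ, Red D (l.map κ) (P.rename ρ κ) (P'.rename ρ κ) := by
  induction h with
  | delay q P M => exact fun ρ κ => .delay _ _ _
  | tau P M => exact fun ρ κ => .tau _ _
  | comm x y P Q M N =>
    intro ρ κ
    simp only [Proc.rename, Proc.inst_rename]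
    exact .comm _ _ _ _ _ _
  | par Q _ ih => exact fun ρ κ => .par _ (ih ρ κ)
  | res _ ih => exact fun ρ κ => .res (ih _ κ)
  | @sres l _ _ r _ ih =>
    intro ρ κ
    have := ih ρ (up κ)
    rw [Option.map_map, up_comp_succ, ← Option.map_map] at this
    exact .sres r this
  | cong h₁ _ h₂ ih => exact fun ρ κ => .cong (h₁.rename ρ κ) (ih ρ κ) (h₂.rename ρ κ)

theorem Summ.exists_cong_of_mem_delays : ∀ {M : Summ S} {k : DelayKind} {e : CongClass D},
    (k, e) ∈ M.delays D → ∃ α P N, (Sum.elim Prefix.rate Prefix.delay k) = α ∧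
      Cong D (.sum M) (.sum (.plus (.pre α P) N))
  | .nil, k, e, h => by simp [Summ.delays] at h
  | .pre α P, k, e, h => by
    refine ⟨α, P, .nil, ?_, (Cong.plusNil _).symm⟩
    cases α <;> simp_all [Summ.delays]
  | .plus M N, k, e, h => by
    rcases Multiset.mem_add.1 h with h | h
    · obtain ⟨α, P, N', e, c⟩ := Summ.exists_cong_of_mem_delays h
      exact ⟨α, P, _, e, (Cong.plusCongr c (.refl _)).trans (.plusAssoc _ _ _)⟩
    · obtain ⟨α, P, N', e, c⟩ := Summ.exists_cong_of_mem_delays h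
      exact ⟨α, P, _, e, (Cong.plusComm _ _).trans
        ((Cong.plusCongr c (.refl _)).trans (.plusAssoc _ _ _))⟩

/-- A partial converse of `Red.mem_delays`. The class of the target is not tracked, because an
active binder requires only that some transition exists. -/
theorem Proc.exists_red_of_mem_delays (hv : v.Coherent) (P : Proc S) : ∀ q e,
    (Sum.inr q, e) ∈ P.delays v → ∃ P', Red D (some q) P P' := by
  induction P using D.proc_induction with
  | sum M =>
    intro q e h
    obtain ⟨_, P, N, rfl, c⟩ := Summ.exists_cong_of_mem_delays h
    exact ⟨P, .cong c (.delay q P N) (.refl _)⟩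
  | par P Q ihP ihQ =>
    intro q e h
    rcases Multiset.mem_add.1 h with h | h
    · obtain ⟨⟨_, e'⟩, h', ⟨⟩⟩ := Multiset.mem_map.1 h
      obtain ⟨P', h⟩ := ihP q e' h'
      exact ⟨_, .par Q h⟩
    · obtain ⟨⟨_, e'⟩, h', ⟨⟩⟩ := Multiset.mem_map.1 h
      obtain ⟨P', h⟩ := ihQ q e' h'
      exact ⟨_, .cong (.parComm _ _) (.par P h) (.refl _)⟩
  | res P ih =>
    intro q e h
    obtain ⟨⟨_, e'⟩, h', ⟨⟩⟩ := Multiset.mem_map.1 h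
    obtain ⟨P', h⟩ := ih q e' h'
    exact ⟨_, .res h⟩
  | sres r P ih =>
    intro q e h
    obtain ⟨⟨k, e'⟩, h', hk⟩ := Multiset.mem_map.1 h
    rcases k with _ | _ | k <;>
      simp only [Prod.map, DelayKind.bind, Prod.mk.injEq, reduceCtorEq, false_and,
        Sum.inr.injEq] at hk
    obtain ⟨rfl, _⟩ := hk
    obtain ⟨P', h⟩ := ih _ e' h'
    exact ⟨_, .sres r h⟩
  | call A y _ => exact fun q e h => (hv.not_inr_mem A y q e h).elim

/-- A term with an unguarded delay that is numerical or bound has an active binder. -/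
theorem Proc.activeBinder_of_mem_delays (hv : v.Coherent) (P : Proc S) : ∀ s e,
    (Sum.inl s, e) ∈ P.delays v → ActiveBinder D P := by
  induction P using D.proc_induction with
  | sum M =>
    intro s e h
    obtain ⟨_, P, N, rfl, c⟩ := Summ.exists_cong_of_mem_delays h
    -- The law for `(r)` trades the numerical prefix for a binder that is active at once.
    exact ⟨s, _, _, c.trans (.rate s P N), .delay 0 _ _⟩
  | par P Q ihP ihQ =>
    intro s e h
    rcases Multiset.mem_add.1 h with h | h
    · obtain ⟨⟨_, e'⟩, h', ⟨⟩⟩ := Multiset.mem_map.1 h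
      obtain ⟨r, R, R', c, hR⟩ := ihP s e' h'
      exact ⟨r, _, _, (c.parLeft Q).trans (.sresPar _ _ _), .par _ hR⟩
    · obtain ⟨⟨_, e'⟩, h', ⟨⟩⟩ := Multiset.mem_map.1 h
      obtain ⟨r, R, R', c, hR⟩ := ihQ s e' h'
      exact ⟨r, _, _, (Cong.parComm _ _).trans ((c.parLeft P).trans (.sresPar _ _ _)), .par _ hR⟩
  | res P ih =>
    intro s e h
    obtain ⟨⟨_, e'⟩, h', ⟨⟩⟩ := Multiset.mem_map.1 h
    obtain ⟨r, R, R', c, hR⟩ := ih s e' h'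
    exact ⟨r, _, _, (Cong.resCongr c).trans (.resSres _ _), .res hR⟩
  | sres r P ih =>
    intro s e h
    obtain ⟨⟨k, e'⟩, h', hk⟩ := Multiset.mem_map.1 h
    rcases k with s' | _ | k <;>
      simp only [Prod.map, DelayKind.bind, Prod.mk.injEq, reduceCtorEq, false_and] at hk
    · obtain ⟨r', R, R', c, hR⟩ := ih s' e' h'
      -- The delay was already rated below this binder, so the inner active binder is exchanged with
      -- it and brought outside.
      exact ⟨r', _, _, (Cong.sresCongr r c).trans (.sresSres _ _ _),
        .sres r (hR.rename id swap01)⟩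
    -- Here the rate comes from this very binder, which is therefore active itself.
    · obtain ⟨P', h⟩ := Proc.exists_red_of_mem_delays hv P _ _ h'
      exact ⟨r, P, P', .refl _, h⟩
  | call A y ih =>
    intro s e h
    rw [Proc.delays, hv] at h
    obtain ⟨r, R, R', c, hR⟩ := ih s e h
    exact ⟨r, R, R', (Cong.call A y).trans c, hR⟩

end Active

-- Affine terms and the content of stochastic transitions.

section Affine

variable {S : Sig.{u}} {D : Env S} {v : DelayEnv D}

/-- Every unguarded stochastic binder binds at most one unguarded delay. -/
def Proc.Affine : Proc S → Prop
  | .sum _ => True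
  | .par P Q => P.Affine ∧ Q.Affine
  | .res P => P.Affine
  | .sres _ P => P.free 0 ≤ 1 ∧ P.Affine
  | .call _ _ => True

theorem Proc.affine_rename : ∀ (P : Proc S) (ρ : ℕ → ℕ) {κ : ℕ → ℕ}
    (_ : Function.Injective κ), (P.rename ρ κ).Affine ↔ P.Affine
  | .sum _, _, _, _ => Iff.rfl
  | .par P Q, ρ, κ, h => and_congr (Proc.affine_rename P ρ h) (Proc.affine_rename Q ρ h)
  | .res P, ρ, κ, h => Proc.affine_rename P (up ρ) h
  | .sres r P, ρ, κ, h => by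
    have := Proc.free_rename P ρ (up_injective h) 0
    simp only [up] at this
    simp only [Proc.rename, Proc.Affine, this, Proc.affine_rename P ρ (up_injective h)]
  | .call _ _, _, _, _ => Iff.rfl

theorem Proc.Plain.affine : ∀ {P : Proc S}, P.Plain → P.Affine
  | .sum _, _ => trivial
  | .par P Q, h => ⟨Proc.Plain.affine (P := P) h.1, Proc.Plain.affine (P := Q) h.2⟩
  | .res P, h => Proc.Plain.affine (P := P) h
  | .sres _ _, h => h.elim
  | .call _ _, _ => trivial

/-- Counts of free unguarded delays are congruence invariants, and scope laws only bring in terms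
that avoid the bound name. The law for `(r)` introduces a binder of exactly one delay, since the
name is fresh for `M`. -/
theorem Cong.affine_iff {P Q : Proc S} (h : Cong D P Q) : P.Affine ↔ Q.Affine := by
  have hid : Function.Injective (id : ℕ → ℕ) := Function.injective_id
  obtain ⟨w, hw⟩ := D.exists_count
  induction h with
  | refl P => rfl
  | symm _ ih => exact ih.symm
  | trans _ _ ih₁ ih₂ => exact ih₁.trans ih₂
  | parCongr _ _ ih₁ ih₂ => simp only [Proc.Affine, ih₁, ih₂]
  | resCongr _ ih => exact ih
  | sresCongr r h ih => simp only [Proc.Affine, ih, (h.count_eq hw).1 0]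
  | preCongr α _ _ => rfl
  | plusCongr _ _ _ _ => rfl
  | resPar P Q => simp only [Proc.Affine, Proc.shift, Proc.affine_rename Q _ hid]
  | sresPar r P Q =>
    have := Proc.free_rename_zero Q id (κ := Nat.succ) (q := 0) (fun n => Nat.succ_ne_zero n)
    simp only [Proc.Affine, Proc.free, Proc.sshift, this, add_zero,
      Proc.affine_rename Q _ Nat.succ_injective, and_assoc]
  | resRes P => simp only [Proc.Affine, Proc.affine_rename P _ hid]
  | resSres r P => rfl
  | sresSres r s P =>
    have h0 := Proc.free_rename P id swap01_injective 0
    have h1 := Proc.free_rename P id swap01_injective 1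
    simp only [swap01] at h0 h1
    simp only [Proc.Affine, Proc.free, h0, h1, zero_add, Proc.affine_rename P _ swap01_injective]
    tauto
  | resNil => rfl
  | sresNil r => simp [Proc.Affine, Proc.free, Proc.nil, Summ.free]
  | plusAssoc M₁ M₂ M₃ => rfl
  | plusComm M N => rfl
  | plusNil M => rfl
  | parAssoc P₁ P₂ P₃ => simp only [Proc.Affine, and_assoc]
  | parComm P Q => simp only [Proc.Affine, and_comm]
  | parNil P => simp [Proc.Affine, Proc.nil]
  | call A y => exact iff_of_true trivial (D.substParams_plain A y).affine
  | rate r P M =>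
    have := Summ.free_rename_zero id (κ := Nat.succ) (q := 0) (fun n => Nat.succ_ne_zero n) M
    simp [Proc.Affine, Proc.free, Summ.free, Summ.sshift, this]

/-- The rate and target class of a delay with a rate. -/
def rated {X : Type u} : DelayKind × X → Option (Rate × X)
  | (.inl r, e) => some (r, e)
  | (.inr _, _) => none

/-- The target class of a delay with the stochastic name `q`. -/
def named {X : Type u} (q : ℕ) : DelayKind × X → Option X
  | (.inl _, _) => none
  | (.inr q', e) => if q' = q then some e else none

theorem filterMap_named_map_id {X Y : Type u} (q : ℕ) (g : X → Y)
    (s : Multiset (DelayKind × X)) :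
    ((s.map (Prod.map id g)).filterMap (named q)) = (s.filterMap (named q)).map g := by
  rw [Multiset.filterMap_map, Multiset.map_filterMap]
  congr 1
  funext ⟨k, e⟩
  rcases k with _ | q'
  · rfl
  · by_cases h : q' = q <;> simp [named, h]

theorem filterMap_named_map_bind {X Y : Type u} (q : ℕ) (r : Rate) (g : X → Y)
    (s : Multiset (DelayKind × X)) :
    ((s.map (Prod.map (DelayKind.bind r) g)).filterMap (named q))
      = (s.filterMap (named (q + 1))).map g := by
  rw [Multiset.filterMap_map, Multiset.map_filterMap]
  congr 1
  funext ⟨k, e⟩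
  rcases k with _ | _ | q'
  · rfl
  · simp [named, DelayKind.bind]
  · by_cases h : q' = q <;> simp [named, DelayKind.bind, h]

/-- Binding adds to the delays that are already rated those carrying the bound name. This mirrors
the rule `sto1`, where the image of a distribution is extended by the delay of the active binder. -/
theorem filterMap_rated_map_bind {X Y : Type u} (r : Rate) (g : X → Y)
    (s : Multiset (DelayKind × X)) :
    ((s.map (Prod.map (DelayKind.bind r) g)).filterMap rated)
      = (s.filterMap rated).map (fun p => (p.1, g p.2)) +
        (s.filterMap (named 0)).map fun e => (r, g e) := by
  induction s using Multiset.induction_on with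
  | empty => rfl
  | cons a s ih =>
    obtain ⟨k, e⟩ := a
    rw [Multiset.map_cons]
    rcases k with s' | _ | q'
    · rw [Multiset.filterMap_cons_some rated _ _ (b := (s', g e)) rfl,
        Multiset.filterMap_cons_some rated _ _ (b := (s', e)) rfl,
        Multiset.filterMap_cons_none _ _ (f := named 0) rfl, ih, Multiset.map_cons,
        Multiset.cons_add]
    · rw [Multiset.filterMap_cons_some rated _ _ (b := (r, g e)) rfl,
        Multiset.filterMap_cons_none _ _ (f := rated) rfl,
        Multiset.filterMap_cons_some (named 0) _ _ (b := e) rfl, ih, Multiset.map_cons,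
        Multiset.add_cons]
    · rw [Multiset.filterMap_cons_none _ _ (f := rated) rfl,
        Multiset.filterMap_cons_none _ _ (f := rated) rfl,
        Multiset.filterMap_cons_none _ _ (f := named 0) (by simp [named]), ih]

theorem Summ.card_named_delays (q : ℕ) : ∀ M : Summ S,
    ((M.delays D).filterMap (named q)).card = M.free q
  | .nil => rfl
  | .pre α P => by
    cases α with
    | delay q' =>
      by_cases h : q' = q
      · rw [Summ.delays, ← Multiset.cons_zero,
          Multiset.filterMap_cons_some (named q) _ _ (b := cls D P) (by simp [named, h])]
        simp [Summ.free, h]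
      · rw [Summ.delays, ← Multiset.cons_zero,
          Multiset.filterMap_cons_none _ _ (f := named q) (by simp [named, h])]
        simp [Summ.free, h]
    | _ => rfl
  | .plus M N => by
    simp [Summ.delays, Summ.free, Summ.card_named_delays q M, Summ.card_named_delays q N]

/-- Turns the syntactic bound in `Proc.Affine` into a bound on the number of delays that a binder
binds. -/
theorem Proc.card_named_delays (hv : v.Coherent) : ∀ (P : Proc S) (q : ℕ),
    ((P.delays v).filterMap (named q)).card = P.free q
  | .sum M, q => Summ.card_named_delays q M
  | .par P Q, q => by
    simp [Proc.delays, Proc.free, filterMap_named_map_id, Proc.card_named_delays hv P,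
      Proc.card_named_delays hv Q]
  | .res P, q => by
    simp [Proc.delays, Proc.free, filterMap_named_map_id, Proc.card_named_delays hv P]
  | .sres r P, q => by
    simp [Proc.delays, Proc.free, filterMap_named_map_bind, Proc.card_named_delays hv P]
  | .call A y, q => by
    rw [Proc.free, Multiset.card_eq_zero, Multiset.eq_zero_iff_forall_notMem]
    intro e he
    obtain ⟨⟨k | p, f⟩, h, hk⟩ := (Multiset.mem_filterMap _ _).1 he
    · cases hk
    · exact hv.not_inr_mem A y p f h

/-- The stochastic transitions of a term in which every binder binds at most one delay collect
all delays that are numerical or bound. -/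
theorem Sto.eq_delays (hv : v.Coherent) {P : Proc S} {σ : RDist (CongClass D)}
    (h : Sto D P σ) : P.Affine → σ.1 = (P.delays v).filterMap rated := by
  -- The premise of a stochastic rule chooses one symbolic transition; affinity makes its target
  -- class the only possible one.
  have bound : ∀ {P P' : Proc S}, P.free 0 ≤ 1 → Red D (some 0) P P' →
      (P.delays v).filterMap (named 0) = {cls D P'} := by
    intro P P' h₁ h₂
    have hmem : cls D P' ∈ (P.delays v).filterMap (named 0) :=
      (Multiset.mem_filterMap _ _).2 ⟨_, h₂.mem_delays hv 0 rfl, by simp [named]⟩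
    obtain ⟨t, ht⟩ := Multiset.exists_cons_of_mem hmem
    rw [← Proc.card_named_delays hv, ht, Multiset.card_cons] at h₁
    have : t = 0 := Multiset.card_eq_zero.1 (by omega)
    rw [ht, this]
    rfl
  induction h with
  | sto1 r _ hr ih =>
    intro ha
    rw [Proc.delays, filterMap_rated_map_bind, bound ha.1 hr, ← ih ha.2]
    rfl
  | @sto2 P P' r hN hr =>
    intro ha
    -- Any rated delay under the binder would give an active binder, against the negative premise.
    have : (P.delays v).filterMap rated = 0 := by
      rw [Multiset.eq_zero_iff_forall_notMem]
      intro p hp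
      obtain ⟨⟨k | q, e⟩, h, h'⟩ := (Multiset.mem_filterMap _ _).1 hp
      · exact hN (Proc.activeBinder_of_mem_delays hv P k e h)
      · cases h'
    rw [Proc.delays, filterMap_rated_map_bind, bound ha.1 hr, this]
    rfl
  | cong h _ ih =>
    intro ha
    rw [ih (h.affine_iff.1 ha), h.delays_eq hv]

end Affine

-- Harmony of stochastic and Markovian transitions.

section Harmony

variable {S : Sig.{u}} {D : Env S}

/-- Both sides say that the term has a rated delay: an active binder contributes one and is obtained
from one, and on plain terms the delays are the Markovian transitions. -/
theorem exists_sto_iff_exists_mtrans {P : Proc S} (hP : P.Plain) :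
    (∃ σ, Sto D P σ) ↔ ∃ r i P', MTrans D P r i P' := by
  obtain ⟨v, hv⟩ := D.exists_delayEnv
  obtain ⟨m, ⟨_, hm⟩, em⟩ := Proc.exists_enumerates hv P hP
  rw [exists_sto_iff]
  constructor
  · rintro ⟨r, Q, Q', h₁, h₂⟩
    have : (Sum.inl r, sresClass D r (cls D Q')) ∈ P.delays v := by
      rw [h₁.delays_eq hv]
      exact Multiset.mem_map_of_mem (Prod.map (DelayKind.bind r) _) (h₂.mem_delays hv 0 rfl)
    rw [← em] at this
    obtain ⟨t, ht, _⟩ := Multiset.mem_map.1 this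
    exact ⟨_, _, _, (hm t).1 ht⟩
  · rintro ⟨r, i, P', h⟩
    refine Proc.activeBinder_of_mem_delays hv P r (cls D P') ?_
    rw [← em]
    exact Multiset.mem_map_of_mem (delayOf D) ((hm (r, i, P')).2 h)

open Classical in
-- Weighting distinct pairs by multiplicity is summation over the multiset, a form that can be
-- transported along the enumeration of transitions.
theorem RDist.rateTo_eq_sum {X : Type u} (σ : RDist X) (e : X) :
    σ.rateTo e = ((σ.1.filter fun p => p.2 = e).map fun p => (p.1 : ℝ)).sum := by
  rw [Finset.sum_multiset_map_count, RDist.rateTo, Multiset.toFinset_filter]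
  refine Finset.sum_congr rfl fun p hp => ?_
  rw [Multiset.count_filter, if_pos (Finset.mem_filter.1 hp).2, nsmul_eq_mul, mul_comm]

/-- Harmony of the rates of stochastic and Markovian transitions. -/
theorem Sto.rateTo_eq {P : Proc S} (hP : P.Plain) {σ : RDist (CongClass D)} (h : Sto D P σ)
    (P' : Proc S) : (markovInto D P P').Finite ∧
      σ.rateTo (cls D P') = ∑ᶠ t ∈ markovInto D P P', (t.1 : ℝ) := by
  classical
  obtain ⟨v, hv⟩ := D.exists_delayEnv
  obtain ⟨m, ⟨hm, hm'⟩, em⟩ := Proc.exists_enumerates hv P hP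
  -- Affinity identifies the distribution with the rated delays, and plainness identifies these with
  -- the enumerated transitions.
  have hσ : σ.1 = m.map fun t => (t.1, cls D t.2.2) := by
    rw [h.eq_delays hv hP.affine, ← em, Multiset.filterMap_map, ← Multiset.filterMap_eq_map]
    rfl
  let F : Finset (Rate × List Pos × Proc S) :=
    Finset.filter (fun t => Cong D t.2.2 P') ⟨m, hm⟩
  have hF : markovInto D P P' = F := by
    ext t
    simp [F, markovInto, hm']
  refine ⟨hF ▸ F.finite_toSet, ?_⟩
  rw [hF, finsum_mem_coe_finset, RDist.rateTo_eq_sum, hσ, Multiset.filter_map, Multiset.map_map]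
  simp only [Function.comp_def, cls_eq_iff]
  rfl

end Harmony

end MPi

theorem mainTheorem1 {S : MPi.Sig.{u}} (D : MPi.Env S) (P : MPi.Proc S) (hP : P.Plain) :
    (∀ P' : MPi.Proc S,
      MPi.Red D none P P' ↔ ∃ Q, MPi.LTrans D P (.free .tau) Q ∧ MPi.Cong D Q P') ∧
    ((∃ σ, MPi.Sto D P σ) ↔ ∃ r i P', MPi.MTrans D P r i P') ∧
    (∀ σ, MPi.Sto D P σ → (∃ r i P', MPi.MTrans D P r i P') →
      ∀ P' : MPi.Proc S, P'.Plain →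
        (MPi.markovInto D P P').Finite ∧
        σ.rateTo (MPi.cls D P') = ∑ᶠ t ∈ MPi.markovInto D P P', (t.1 : ℝ)) :=
  ⟨MPi.red_iff_ltrans_tau hP, MPi.exists_sto_iff_exists_mtrans hP,
    fun _ h _ P' _ => h.rateTo_eq hP P'⟩
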